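/- For a graph $G$ and integers $1\le l<d$, let $\sigma^l_d(G)$ denote the minimum number of $l$-dimensional spheres in $\mathbb{R}^d$ (circles if $l=1$) whose union contains a crossing-free drawing of $G$ in $\mathbb{R}^d$ in which every edge is drawn as a circular arc. Then for infinitely many $n$ there is a planar graph $G$ on $n$ vertices with $\sigma^1_2(G)=\Omega(n)$ and $\sigma^1_3(G)=O(n^{2/3})$. More precisely, let $G_i=C_3\times P_i$ be the Cartesian product of a triangle and a path on $i$ vertices. There are constants $c,C>0$ such that, for every integer $i\ge 1$, the graph $G_i$ has $n=3i$ vertices, is planar, and $\sigma^1_2(G_i)$ and $\sigma^1_3(G_i)$ are finite with $$\sigma^1_2(G_i)\ \ge\ c\,n \qquad\text{and}\qquad \sigma^1_3(G_i)\ \le\ C\,n^{2/3}.$$ -/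

import Mathlib

/-- `S` is an `l`-dimensional sphere in `ℝ^d`: the set of all points of some
`(l + 1)`-dimensional affine subspace at a fixed positive distance from a centre in it.
For `l = 1` these are the circles in `ℝ^d`. -/
def IsSphereOfDim {d : ℕ} (l : ℕ) (S : Set (EuclideanSpace ℝ (Fin d))) : Prop :=
  ∃ (A : AffineSubspace ℝ (EuclideanSpace ℝ (Fin d))) (c : EuclideanSpace ℝ (Fin d)) (r : ℝ),
    Module.finrank ℝ A.direction = l + 1 ∧ c ∈ A ∧ 0 < r ∧ S = {x | x ∈ A ∧ dist x c = r}

/-- `K` is a circular arc in `ℝ^d` from `p` to `q`: the part between angles `α` and `β`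
(less than a full turn) of a circle with centre `c`, radius `r > 0`, in the plane through `c`
spanned by orthonormal vectors `u`, `v`. -/
def IsCircularArc {d : ℕ} (K : Set (EuclideanSpace ℝ (Fin d)))
    (p q : EuclideanSpace ℝ (Fin d)) : Prop :=
  ∃ (c u v : EuclideanSpace ℝ (Fin d)) (r α β : ℝ),
    ‖u‖ = 1 ∧ ‖v‖ = 1 ∧ inner ℝ u v = 0 ∧ 0 < r ∧ α < β ∧ β < α + 2 * Real.pi ∧
    p = c + (r * Real.cos α) • u + (r * Real.sin α) • v ∧
    q = c + (r * Real.cos β) • u + (r * Real.sin β) • v ∧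
    K = (fun θ : ℝ => c + (r * Real.cos θ) • u + (r * Real.sin θ) • v) '' Set.Icc α β

/-- `K` is a simple (Jordan) arc in `ℝ^d` from `p` to `q`. -/
def IsSimpleArc {d : ℕ} (K : Set (EuclideanSpace ℝ (Fin d)))
    (p q : EuclideanSpace ℝ (Fin d)) : Prop :=
  ∃ γ : ℝ → EuclideanSpace ℝ (Fin d),
    ContinuousOn γ (Set.Icc 0 1) ∧ Set.InjOn γ (Set.Icc 0 1) ∧ γ 0 = p ∧ γ 1 = q ∧
    K = γ '' Set.Icc 0 1

/-- The placement `pos` of the vertices and `arc` of the edges of `G` is crossing-free: distinct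
vertices are distinct points, an edge contains no vertices but its endpoints, and distinct edges
meet in common endpoints only. -/
def IsCrossingFree {V : Type*} {d : ℕ} (G : SimpleGraph V)
    (pos : V → EuclideanSpace ℝ (Fin d)) (arc : Sym2 V → Set (EuclideanSpace ℝ (Fin d))) : Prop :=
  Function.Injective pos ∧
  (∀ e ∈ G.edgeSet, ∀ w : V, pos w ∈ arc e → w ∈ e) ∧
  (∀ e ∈ G.edgeSet, ∀ f ∈ G.edgeSet, e ≠ f → ∀ x ∈ arc e ∩ arc f, ∃ w : V, w ∈ e ∧ w ∈ f ∧ x = pos w)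

/-- A crossing-free drawing of `G` in `ℝ^d` in which every edge is a circular arc joining its
endpoints. -/
def IsCircularArcDrawing {V : Type*} {d : ℕ} (G : SimpleGraph V)
    (pos : V → EuclideanSpace ℝ (Fin d)) (arc : Sym2 V → Set (EuclideanSpace ℝ (Fin d))) : Prop :=
  IsCrossingFree G pos arc ∧
  ∀ a b : V, G.Adj a b → IsCircularArc (arc s(a, b)) (pos a) (pos b)

/-- `G` is planar: it has a crossing-free drawing in the plane with simple arcs as edges. -/
def IsPlanarGraph {V : Type*} (G : SimpleGraph V) : Prop :=
  ∃ (pos : V → EuclideanSpace ℝ (Fin 2)) (arc : Sym2 V → Set (EuclideanSpace ℝ (Fin 2))),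
    IsCrossingFree G pos arc ∧
    ∀ a b : V, G.Adj a b → IsSimpleArc (arc s(a, b)) (pos a) (pos b)

/-- `G` has a crossing-free circular-arc drawing in `ℝ^d` that is contained in the union of
`k` spheres of dimension `l`. -/
def HasSphericalCover {V : Type*} (l d k : ℕ) (G : SimpleGraph V) : Prop :=
  ∃ (pos : V → EuclideanSpace ℝ (Fin d)) (arc : Sym2 V → Set (EuclideanSpace ℝ (Fin d)))
    (S : Fin k → Set (EuclideanSpace ℝ (Fin d))),
    IsCircularArcDrawing G pos arc ∧ (∀ j, IsSphereOfDim l (S j)) ∧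
    (∀ w : V, pos w ∈ ⋃ j, S j) ∧ (∀ e ∈ G.edgeSet, arc e ⊆ ⋃ j, S j)

/-- The spherical cover number `σ_d^l(G)`: the minimum number of `l`-dimensional spheres in `ℝ^d`
whose union contains a crossing-free circular-arc drawing of `G`; it is `⊤` if there is no such
finite family of spheres. -/
noncomputable def sphericalCoverNumber {V : Type*} (l d : ℕ) (G : SimpleGraph V) : ℕ∞ :=
  sInf {m : ℕ∞ | ∃ k : ℕ, m = (k : ℕ∞) ∧ HasSphericalCover l d k G}

/-- The Cartesian product `C₃ × P_i` of a triangle and a path on `i` vertices. -/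
def nestedTriangles (i : ℕ) : SimpleGraph (Fin 3 × Fin i) :=
  (SimpleGraph.cycleGraph 3).boxProd (SimpleGraph.pathGraph i)

/-! Lower bound. In a plane drawing, the straight segment from the first to the last vertex of one
spoke meets every intermediate triangle. Otherwise the three vertices of a missed triangle and their
neighbours below and above on that spoke would be the branch vertices of a K₅ with disjoint edges
drawn disjointly, the last edge running along the spoke and through the segment
(`IsCircularArcDrawing.segment_meets_triangle`). Distinct triangles are disjoint, so the segment
carries i - 2 distinct points of the drawing, and a circle meets a line at most twice; hence i ≤ 2k
+ 2 (`le_of_hasSphericalCover`). The required non-planarity of K₅, `not_planar_drawing_five`, is a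
parity count of winding numbers.

Upper bound. With i ≤ N³, cut the path into at most N² blocks of N levels and draw the blocks as
vertical prisms over the cells of an N × N grid. So many edges are collinear that 7N² lines suffice
inside the blocks (`hasSphericalCover_grid`). Inversion turns lines missing the origin into circles
and is injective (`hasSphericalCover_of_lines`). Each of the at most 3N² spoke edges between blocks
then gets a circle of its own, since space leaves room for an arc avoiding everything else
(`HasSphericalCover.sup_edge`). With N = ⌈i^(1/3)⌉ this totals 10N² = O(i^(2/3)).

Planarity, and finiteness in the plane, come from inverting a drawing by concentric triangles
(`hasSphericalCover_plane`). -/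

/-! ### Non-planarity of K₅ by continuous logarithms -/

theorem exists_continuous_log {A : Type*} [TopologicalSpace A] [SimplyConnectedSpace A]
    [LocallyPathConnectedSpace A] {f : A → ℂ} (hf : Continuous f) (h0 : ∀ a, f a ≠ 0) :
    ∃ L : A → ℂ, Continuous L ∧ ∀ a, Complex.exp (L a) = f a := by
  obtain ⟨a₀⟩ : Nonempty A := inferInstance
  obtain ⟨F, ⟨-, hF⟩, -⟩ := Complex.isCoveringMap_exp.existsUnique_continuousMap_lifts
    (⟨fun a => ⟨f a, h0 a⟩, by fun_prop⟩ : C(A, {z : ℂ // z ≠ 0})) a₀ (Complex.log (f a₀))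
    (Subtype.ext (Complex.exp_log (h0 a₀)))
  exact ⟨F, F.continuous, fun a => congrArg Subtype.val (congrFun hF a)⟩

/-- Lifts through the covering `exp` that agree at one point agree everywhere, so the increment of a
logarithm does not depend on its branch. -/
theorem sub_eq_sub_of_exp_eq {A : Type*} [TopologicalSpace A] [PreconnectedSpace A]
    {L L' : A → ℂ} (hL : Continuous L) (hL' : Continuous L')
    (h : ∀ a, Complex.exp (L a) = Complex.exp (L' a)) (a b : A) :
    L b - L a = L' b - L' a := by
  have := Complex.isCoveringMap_exp.eq_of_comp_eq (g₁ := fun x => L x)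
    (g₂ := fun x => L' x + (L a - L' a)) hL (by fun_prop)
    (by
      funext x
      refine Subtype.ext ?_
      simp only [Function.comp_apply]
      rw [Complex.exp_add, Complex.exp_sub, h a, h x, div_self (Complex.exp_ne_zero _), mul_one])
    a (by ring)
  have := congrFun this b
  rw [this]; ring

/-- The complete graph on five vertices has no continuous drawing in the plane in which disjoint
edges are disjoint. -/
theorem not_planar_drawing_five (P : Fin 5 → ℂ) (γ : Fin 5 → Fin 5 → ℝ → ℂ)
    (hc : ∀ a b, a < b → Continuous (γ a b))
    (h0 : ∀ a b, a < b → γ a b 0 = P a) (h1 : ∀ a b, a < b → γ a b 1 = P b)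
    (hd : ∀ a b c d, a < b → c < d → a ≠ c → a ≠ d → b ≠ c → b ≠ d →
      ∀ s t, γ a b s ≠ γ c d t) : False := by
  -- A fifth vertex `w` makes `P v` an endpoint of an edge disjoint from `ab`.
  have hv : ∀ a b v, a < b → v ≠ a → v ≠ b → ∀ s, γ a b s ≠ P v := by
    intro a b v hab hva hvb s
    obtain ⟨w, hw⟩ : ∃ w : Fin 5, w ≠ v ∧ w ≠ a ∧ w ≠ b := by
      revert a b v; decide
    rcases lt_or_gt_of_ne hw.1 with h | h
    · rw [← h1 w v h]; exact hd a b w v hab h hw.2.1.symm hva.symm hw.2.2.symm hvb.symm s 1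
    · rw [← h0 v w h]; exact hd a b v w hab h hva.symm hw.2.1.symm hvb.symm hw.2.2.symm s 0
  have hP : ∀ u v, u ≠ v → P u - P v ≠ 0 := by
    intro u v huv
    obtain ⟨w, hw⟩ : ∃ w : Fin 5, w ≠ u ∧ w ≠ v := by revert u v; decide
    rw [sub_ne_zero]
    rcases lt_or_gt_of_ne hw.1 with h | h
    · rw [← h1 w u h]; exact hv w u v h hw.2.symm huv.symm 1
    · rw [← h0 u w h]; exact hv u w v h huv.symm hw.2.symm 0
  have hLex : ∀ v a b : Fin 5, ∃ L : ℝ → ℂ, (a < b → v ≠ a → v ≠ b →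
      Continuous L ∧ ∀ t, Complex.exp (L t) = γ a b t - P v) := by
    intro v a b
    by_cases h : a < b ∧ v ≠ a ∧ v ≠ b
    · have := hc a b h.1
      obtain ⟨L, hL⟩ := exists_continuous_log (f := fun t => γ a b t - P v) (by fun_prop)
        (fun t => sub_ne_zero.2 (hv a b v h.1 h.2.1 h.2.2 t))
      exact ⟨L, fun _ _ _ => hL⟩
    · exact ⟨0, fun h1 h2 h3 => (h ⟨h1, h2, h3⟩).elim⟩
  choose L hL using hLex
  -- Logarithms of all differences `P u - P v`, chosen so that swapping `u` and `v` changes them by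
  -- exactly ±πi, with the sign `sg` read off from the order.
  let z : Fin 5 → Fin 5 → ℂ := fun u v =>
    if u < v then Complex.log (P u - P v) else Complex.log (P v - P u) + Real.pi * Complex.I
  let sg : Fin 5 → Fin 5 → ℤ := fun u v => if u < v then -1 else 1
  have hz : ∀ u v, u ≠ v → Complex.exp (z u v) = P u - P v := by
    intro u v huv
    by_cases h : u < v
    · simp only [z, h, if_true]; exact Complex.exp_log (hP u v huv)
    · simp only [z, h, if_false]
      rw [Complex.exp_add, Complex.exp_log (hP v u huv.symm), Complex.exp_pi_mul_I]; ring
  have hzs : ∀ u v, u ≠ v → z u v - z v u = Real.pi * Complex.I * (sg u v : ℂ) := by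
    intro u v huv
    rcases lt_or_gt_of_ne huv with h | h
    · simp [z, sg, h, h.not_gt]
    · simp [z, sg, h, h.not_gt]
  -- `n v a b` is the winding of the edge `ab` around `P v`, measured against the reference
  -- logarithms `z`.
  have hnex : ∀ v a b : Fin 5, ∃ n : ℤ, (a < b → v ≠ a → v ≠ b →
      L v a b 1 - L v a b 0 = z b v - z a v + n * (2 * Real.pi * Complex.I)) := by
    intro v a b
    by_cases h : a < b ∧ v ≠ a ∧ v ≠ b
    · have hl := (hL v a b h.1 h.2.1 h.2.2).2
      have : Complex.exp (L v a b 1 - L v a b 0) = Complex.exp (z b v - z a v) := by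
        rw [Complex.exp_sub, Complex.exp_sub, hl, hl, hz _ _ h.2.1.symm, hz _ _ h.2.2.symm,
          h0 a b h.1, h1 a b h.1]
      obtain ⟨n, hn⟩ := Complex.exp_eq_exp_iff_exists_int.1 this
      exact ⟨n, fun _ _ _ => hn⟩
    · exact ⟨0, fun h1 h2 h3 => (h ⟨h1, h2, h3⟩).elim⟩
  choose n hn using hnex
  -- The difference of two disjoint edges never vanishes on the parameter square, so it has a
  -- logarithm there and the increments along the four sides sum to zero. On two sides the
  -- difference is the negative of an edge seen from a vertex; this accounts for the shifts by πi.
  have key : ∀ a b c d, a < b → c < d → a ≠ c → a ≠ d → b ≠ c → b ≠ d →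
      2 * (n c a b + n b c d - n d a b - n a c d) + sg b c + sg d b + sg a d + sg c a = 0 := by
    intro a b c d hab hcd hac had hbc hbd
    have c1 := hc a b hab
    have c2 := hc c d hcd
    obtain ⟨M, hMc, hM⟩ := exists_continuous_log (A := ℝ × ℝ)
      (f := fun x => γ a b x.1 - γ c d x.2) (by fun_prop)
      (fun x => sub_ne_zero.2 (hd a b c d hab hcd hac had hbc hbd x.1 x.2))
    have hpi := Complex.exp_pi_mul_I
    have e1 := sub_eq_sub_of_exp_eq (hL c a b hab hac.symm hbc.symm).1
      (L' := fun t => M (t, 0)) (by fun_prop)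
      (fun t => by rw [(hL c a b hab hac.symm hbc.symm).2, hM, h0 c d hcd]) 0 1
    have e2 := sub_eq_sub_of_exp_eq (hL d a b hab had.symm hbd.symm).1
      (L' := fun t => M (t, 1)) (by fun_prop)
      (fun t => by rw [(hL d a b hab had.symm hbd.symm).2, hM, h1 c d hcd]) 0 1
    have e3 := sub_eq_sub_of_exp_eq (hL b c d hcd hbc hbd).1
      (L' := fun t => M (1, t) + Real.pi * Complex.I) (by fun_prop)
      (fun t => by
        rw [(hL b c d hcd hbc hbd).2, Complex.exp_add, hM, h1 a b hab, hpi]; ring) 0 1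
    have e4 := sub_eq_sub_of_exp_eq (hL a c d hcd hac had).1
      (L' := fun t => M (0, t) + Real.pi * Complex.I) (by fun_prop)
      (fun t => by
        rw [(hL a c d hcd hac had).2, Complex.exp_add, hM, h0 a b hab, hpi]; ring) 0 1
    rw [hn c a b hab hac.symm hbc.symm] at e1
    rw [hn d a b hab had.symm hbd.symm] at e2
    rw [hn b c d hcd hbc hbd] at e3
    rw [hn a c d hcd hac had] at e4
    have s1 := hzs b c hbc
    have s2 := hzs d b hbd.symm
    have s3 := hzs a d had
    have s4 := hzs c a hac.symm
    have : ((2 * (n c a b + n b c d - n d a b - n a c d) + sg b c + sg d b + sg a d + sg c a : ℤ)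
        : ℂ) * (Real.pi * Complex.I) = 0 := by
      push_cast
      linear_combination e1 + e3 - e2 - e4 - s1 - s2 - s3 - s4
    have hne : (Real.pi : ℂ) * Complex.I ≠ 0 :=
      mul_ne_zero (by exact_mod_cast Real.pi_ne_zero) Complex.I_ne_zero
    exact_mod_cast (mul_eq_zero.1 this).resolve_right hne
  have k1 := key 0 1 2 3 (by decide) (by decide) (by decide) (by decide) (by decide) (by decide)
  have k2 := key 0 1 2 4 (by decide) (by decide) (by decide) (by decide) (by decide) (by decide)
  have k3 := key 0 1 3 4 (by decide) (by decide) (by decide) (by decide) (by decide) (by decide)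
  have k4 := key 0 2 1 3 (by decide) (by decide) (by decide) (by decide) (by decide) (by decide)
  have k5 := key 0 2 1 4 (by decide) (by decide) (by decide) (by decide) (by decide) (by decide)
  have k6 := key 0 2 3 4 (by decide) (by decide) (by decide) (by decide) (by decide) (by decide)
  have k7 := key 0 3 1 2 (by decide) (by decide) (by decide) (by decide) (by decide) (by decide)
  have k8 := key 0 3 1 4 (by decide) (by decide) (by decide) (by decide) (by decide) (by decide)
  have k9 := key 0 3 2 4 (by decide) (by decide) (by decide) (by decide) (by decide) (by decide)
  have k10 := key 0 4 1 2 (by decide) (by decide) (by decide) (by decide) (by decide) (by decide)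
  have k11 := key 0 4 1 3 (by decide) (by decide) (by decide) (by decide) (by decide) (by decide)
  have k12 := key 0 4 2 3 (by decide) (by decide) (by decide) (by decide) (by decide) (by decide)
  have k13 := key 1 2 3 4 (by decide) (by decide) (by decide) (by decide) (by decide) (by decide)
  have k14 := key 1 3 2 4 (by decide) (by decide) (by decide) (by decide) (by decide) (by decide)
  have k15 := key 1 4 2 3 (by decide) (by decide) (by decide) (by decide) (by decide) (by decide)
  have hsg : ∀ u v, sg u v = if u < v then -1 else 1 := fun _ _ => rfl
  simp only [hsg, Fin.reduceLT, if_true, if_false] at k1 k2 k3 k4 k5 k6 k7 k8 k9 k10 k11 k12 k13 k14 k15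
  -- Each `n v a b` occurs in exactly two of the fifteen relations, one for each partner of `v`
  -- outside `{a, b}`, so together these terms contribute a multiple of 4. The signs contribute 2
  -- for each interleaved pair a < c < b < d and 0 otherwise; five pairs interleave, and 10 is not a
  -- multiple of 4.
  omega

/-- Disjoint path-connected "edges" cannot realise the complete graph on five vertices in the
plane. -/
theorem not_joinedIn_five {X : Type*} [TopologicalSpace X] (φ : X → ℂ) (hφ : Continuous φ)
    (hinj : Function.Injective φ) (P : Fin 5 → X) (K : Fin 5 → Fin 5 → Set X)
    (hJ : ∀ a b, a < b → JoinedIn (K a b) (P a) (P b))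
    (hd : ∀ a b c d, a < b → c < d → a < c → a ≠ d → b ≠ c → b ≠ d →
      Disjoint (K a b) (K c d)) : False := by
  classical
  let γ : Fin 5 → Fin 5 → ℝ → ℂ := fun a b t =>
    if h : a < b then φ ((hJ a b h).somePath.extend t) else 0
  have hγ : ∀ a b, ∀ h : a < b, ∀ t, γ a b t = φ ((hJ a b h).somePath.extend t) :=
    fun a b h t => dif_pos h
  have hmem : ∀ a b, ∀ h : a < b, ∀ t, (hJ a b h).somePath.extend t ∈ K a b := fun a b h t =>
    (hJ a b h).somePath_mem _
  refine not_planar_drawing_five (fun v => φ (P v)) γ (fun a b h => ?_) (fun a b h => ?_)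
    (fun a b h => ?_) (fun a b c d hab hcd hac had hbc hbd s t hst => ?_)
  · rw [funext (hγ a b h)]
    exact hφ.comp (Path.continuous_extend _)
  · simp [hγ a b h]
  · simp [hγ a b h]
  · rw [hγ a b hab, hγ c d hcd] at hst
    have e := hinj hst
    rcases lt_or_gt_of_ne hac with h | h
    · exact Set.disjoint_left.1 (hd a b c d hab hcd h had hbc hbd) (hmem a b hab s)
        (e ▸ hmem c d hcd t)
    · exact Set.disjoint_left.1 (hd c d a b hcd hab h hbc.symm had.symm hbd.symm) (hmem c d hcd t)
        (e ▸ hmem a b hab s)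

/-! ### The lower bound in the plane -/

theorem nestedTriangles_adj {i : ℕ} {a b : Fin 3 × Fin i} :
    (nestedTriangles i).Adj a b ↔ (a.1 ≠ b.1 ∧ a.2 = b.2) ∨
      (a.1 = b.1 ∧ (a.2.val + 1 = b.2.val ∨ b.2.val + 1 = a.2.val)) := by
  rw [nestedTriangles, SimpleGraph.boxProd_adj, SimpleGraph.cycleGraph_three_eq_top,
    SimpleGraph.top_adj, SimpleGraph.pathGraph_adj]
  tauto

theorem IsCircularArc.joinedIn {d : ℕ} {K : Set (EuclideanSpace ℝ (Fin d))}
    {p q : EuclideanSpace ℝ (Fin d)} (h : IsCircularArc K p q) : JoinedIn K p q := by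
  obtain ⟨c, u, v, r, α, β, -, -, -, -, hαβ, -, rfl, rfl, rfl⟩ := h
  have hc : IsPathConnected
      ((fun θ : ℝ => c + (r * Real.cos θ) • u + (r * Real.sin θ) • v) '' Set.Icc α β) :=
    ((convex_Icc α β).isPathConnected ⟨α, Set.left_mem_Icc.2 hαβ.le⟩).image (by fun_prop)
  exact hc.joinedIn _ ⟨α, Set.left_mem_Icc.2 hαβ.le, rfl⟩ _ ⟨β, Set.right_mem_Icc.2 hαβ.le, rfl⟩

/-- The union of the drawn edges of `G` with both endpoints in `W`. -/
def drawnOn {V : Type*} {d : ℕ} (G : SimpleGraph V)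
    (arc : Sym2 V → Set (EuclideanSpace ℝ (Fin d))) (W : Set V) :
    Set (EuclideanSpace ℝ (Fin d)) :=
  {x | ∃ e ∈ G.edgeSet, (∀ v ∈ e, v ∈ W) ∧ x ∈ arc e}

section Drawn

variable {V : Type*} {d : ℕ} {G : SimpleGraph V} {pos : V → EuclideanSpace ℝ (Fin d)}
  {arc : Sym2 V → Set (EuclideanSpace ℝ (Fin d))} {W W' : Set V}

theorem drawnOn_mono (h : W ⊆ W') : drawnOn G arc W ⊆ drawnOn G arc W' := by
  rintro x ⟨e, he, hW, hx⟩
  exact ⟨e, he, fun v hv => h (hW v hv), hx⟩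

theorem IsCrossingFree.disjoint_drawnOn (h : IsCrossingFree G pos arc) (hW : Disjoint W W') :
    Disjoint (drawnOn G arc W) (drawnOn G arc W') := by
  rw [Set.disjoint_left]
  rintro x ⟨e, he, heW, hx⟩ ⟨f, hf, hfW, hx'⟩
  have hne : e ≠ f := by
    rintro rfl
    induction e with
    | h a b =>
      exact Set.disjoint_left.1 hW (heW a (Sym2.mem_mk_left a b)) (hfW a (Sym2.mem_mk_left a b))
  obtain ⟨w, hwe, hwf, -⟩ := h.2.2 e he f hf hne x ⟨hx, hx'⟩
  exact Set.disjoint_left.1 hW (heW w hwe) (hfW w hwf)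

theorem IsCircularArcDrawing.joinedIn_drawnOn (h : IsCircularArcDrawing G pos arc) {a b : V}
    (hab : G.Adj a b) (ha : a ∈ W) (hb : b ∈ W) :
    JoinedIn (drawnOn G arc W) (pos a) (pos b) :=
  (h.2 a b hab).joinedIn.mono fun x hx => ⟨s(a, b), hab, by simp [ha, hb], hx⟩

end Drawn

/-- `F` may exceed the drawn edges: a spoke piece of length 0 has no edge, and then `hm` alone
places its vertex in `F`. -/
theorem IsCircularArcDrawing.joinedIn_spoke {d i : ℕ} {pos : Fin 3 × Fin i → EuclideanSpace ℝ (Fin d)}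
    {arc : Sym2 (Fin 3 × Fin i) → Set (EuclideanSpace ℝ (Fin d))}
    (h : IsCircularArcDrawing (nestedTriangles i) pos arc) {W : Set (Fin 3 × Fin i)}
    {F : Set (EuclideanSpace ℝ (Fin d))} (hF : drawnOn (nestedTriangles i) arc W ⊆ F) (s : Fin 3)
    {m : ℕ} (n : ℕ) (hn : m + n < i) (hm : pos (s, ⟨m, by omega⟩) ∈ F)
    (hW : ∀ k : Fin i, m ≤ k.val → k.val ≤ m + n → (s, k) ∈ W) :
    JoinedIn F (pos (s, ⟨m, by omega⟩)) (pos (s, ⟨m + n, hn⟩)) := by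
  induction n with
  | zero => exact JoinedIn.refl hm
  | succ n ih =>
    refine (ih (by omega) hm (fun k h1 h2 => hW k h1 (by omega))).trans
      ((h.joinedIn_drawnOn (W := W) ?_ ?_ ?_).mono hF)
    · rw [nestedTriangles_adj]; right; exact ⟨rfl, Or.inl rfl⟩
    · exact hW _ (by simp) (by simp)
    · exact hW _ (Nat.le_add_right _ _) le_rfl

/-- In the plane, the segment from the first to the last vertex of a spoke meets every triangle
strictly between. -/
theorem IsCircularArcDrawing.segment_meets_triangle {i : ℕ}
    {pos : Fin 3 × Fin i → EuclideanSpace ℝ (Fin 2)}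
    {arc : Sym2 (Fin 3 × Fin i) → Set (EuclideanSpace ℝ (Fin 2))}
    (h : IsCircularArcDrawing (nestedTriangles i) pos arc) {j : ℕ} (hj : j + 2 < i) :
    ∃ x ∈ segment ℝ (pos (0, ⟨0, by omega⟩)) (pos (0, ⟨i - 1, by omega⟩)),
      x ∈ drawnOn (nestedTriangles i) arc {v | v.2.val = j + 1} := by
  by_contra hcon
  set p := pos (0, ⟨0, by omega⟩) with hp
  set q := pos (0, ⟨i - 1, by omega⟩) with hq
  have hdis : Disjoint (drawnOn (nestedTriangles i) arc {v | v.2.val = j + 1}) (segment ℝ p q) :=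
    Set.disjoint_left.2 fun x hx hx' => hcon ⟨x, hx', hx⟩
  let Y : Fin 3 → Fin 3 × Fin i := fun s => (s, ⟨j, by omega⟩)
  let X : Fin 3 → Fin 3 × Fin i := fun s => (s, ⟨j + 1, by omega⟩)
  let Z : Fin 3 → Fin 3 × Fin i := fun s => (s, ⟨j + 2, by omega⟩)
  let D := drawnOn (nestedTriangles i) arc
  let S : Set (Fin 3 × Fin i) := {v | v.1 = 0 ∧ v.2.val ≠ j + 1}
  -- Branch vertices 0, 1, 2 are the triangle `X`; 3 and 4 are `Y 0` and `Z 0`, reached from `X 1`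
  -- and `X 2` through the adjacent triangles. Edge 34 follows spoke 0 out to both ends and closes
  -- up along the segment. Only the edges of the triangle `X` have to avoid it, so the segment may
  -- cross anything else. Entries with a ≥ b are never used.
  let K : Fin 5 → Fin 5 → Set (EuclideanSpace ℝ (Fin 2)) :=
    ![![∅, D {X 0, X 1}, D {X 0, X 2}, D {X 0, Y 0}, D {X 0, Z 0}],
      ![∅, ∅, D {X 1, X 2}, D {X 1, Y 1, Y 0}, D {X 1, Z 1, Z 0}],
      ![∅, ∅, ∅, D {X 2, Y 2, Y 0}, D {X 2, Z 2, Z 0}],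
      ![∅, ∅, ∅, ∅, D S ∪ segment ℝ p q],
      ![∅, ∅, ∅, ∅, ∅]]
  have hXX : ∀ s t, s ≠ t → (nestedTriangles i).Adj (X s) (X t) := fun s t hst =>
    nestedTriangles_adj.2 (Or.inl ⟨hst, rfl⟩)
  have hYY : ∀ s t, s ≠ t → (nestedTriangles i).Adj (Y s) (Y t) := fun s t hst =>
    nestedTriangles_adj.2 (Or.inl ⟨hst, rfl⟩)
  have hZZ : ∀ s t, s ≠ t → (nestedTriangles i).Adj (Z s) (Z t) := fun s t hst =>
    nestedTriangles_adj.2 (Or.inl ⟨hst, rfl⟩)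
  have hXY : ∀ s, (nestedTriangles i).Adj (X s) (Y s) := fun s =>
    nestedTriangles_adj.2 (Or.inr ⟨rfl, Or.inr rfl⟩)
  have hXZ : ∀ s, (nestedTriangles i).Adj (X s) (Z s) := fun s =>
    nestedTriangles_adj.2 (Or.inr ⟨rfl, Or.inl rfl⟩)
  have hDisj : ∀ W W', Disjoint W W' → Disjoint (D W) (D W') := fun W W' hW =>
    h.1.disjoint_drawnOn hW
  have hDL : ∀ s t, Disjoint (D {X s, X t}) (D S ∪ segment ℝ p q) := by
    intro s t
    refine Set.disjoint_union_right.2 ⟨hDisj _ _ ?_, hdis.mono_left (drawnOn_mono ?_)⟩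
    · simp [Set.disjoint_left, X, S]
    · rintro v (rfl | rfl) <;> rfl
  refine not_joinedIn_five (fun x : EuclideanSpace ℝ (Fin 2) => (⟨x 0, x 1⟩ : ℂ)) ?_ ?_
    (fun v => pos (![X 0, X 1, X 2, Y 0, Z 0] v)) K ?_ ?_
  · have : (fun x : EuclideanSpace ℝ (Fin 2) => (⟨x 0, x 1⟩ : ℂ)) =
        fun x => (x 0 : ℂ) + (x 1 : ℂ) * Complex.I := by
      funext x; apply Complex.ext <;> simp
    rw [this]; fun_prop
  · intro x y hxy
    have := Complex.ext_iff.1 hxy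
    ext k; fin_cases k
    · exact this.1
    · exact this.2
  · have h34 : JoinedIn (D S ∪ segment ℝ p q) (pos (Y 0)) (pos (Z 0)) := by
      have hpq : JoinedIn (D S ∪ segment ℝ p q) p q :=
        (JoinedIn.of_segment_subset (Set.Subset.refl _)).mono Set.subset_union_right
      have e1 : JoinedIn (D S ∪ segment ℝ p q) p (pos (Y 0)) := by
        have := h.joinedIn_spoke (W := S) (F := D S ∪ segment ℝ p q) Set.subset_union_left 0
          (m := 0) j (by omega) hpq.source_mem
          (fun k _ hk => ⟨rfl, by dsimp only; omega⟩)
        simpa [Y] using this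
      have e2 : JoinedIn (D S ∪ segment ℝ p q) (pos (Z 0)) q := by
        have hz : pos (Z 0) ∈ D S ∪ segment ℝ p q := by
          -- If level `j + 2` is the last one, no edge of `S` starts at `Z 0`, but then `Z 0` is the
          -- end `q` of the segment.
          rcases Nat.lt_or_ge (j + 3) i with hi | hi
          · refine Or.inl (h.joinedIn_drawnOn (W := S) (a := Z 0) (b := (0, ⟨j + 3, hi⟩))
              (nestedTriangles_adj.2 (Or.inr ⟨rfl, Or.inl rfl⟩)) ?_ ?_).source_mem <;>
              simp [S, Z]
          · have : Z 0 = (0, ⟨i - 1, by omega⟩) := by simp [Z]; omega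
            rw [this]
            exact hpq.target_mem
        have := h.joinedIn_spoke (W := S) (F := D S ∪ segment ℝ p q) Set.subset_union_left 0
          (m := j + 2) (i - 1 - (j + 2)) (by omega) hz
          (fun k hk _ => ⟨rfl, by dsimp only; omega⟩)
        have e : j + 2 + (i - 1 - (j + 2)) = i - 1 := by omega
        simpa [e] using this
      exact (e1.symm.trans hpq).trans e2.symm
    have : ∀ a b : Fin 5, a < b → (a, b) ∈ [((0 : Fin 5), (1 : Fin 5)), (0, 2), (0, 3), (0, 4),
        (1, 2), (1, 3), (1, 4), (2, 3), (2, 4), (3, 4)] := by decide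
    intro a b hab
    have := this a b hab
    simp only [List.mem_cons, Prod.mk.injEq, List.not_mem_nil, or_false] at this
    rcases this with ⟨rfl, rfl⟩ | ⟨rfl, rfl⟩ | ⟨rfl, rfl⟩ | ⟨rfl, rfl⟩ | ⟨rfl, rfl⟩ |
      ⟨rfl, rfl⟩ | ⟨rfl, rfl⟩ | ⟨rfl, rfl⟩ | ⟨rfl, rfl⟩ | ⟨rfl, rfl⟩
    · exact h.joinedIn_drawnOn (hXX 0 1 (by decide)) (by simp) (by simp)
    · exact h.joinedIn_drawnOn (hXX 0 2 (by decide)) (by simp) (by simp)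
    · exact h.joinedIn_drawnOn (hXY 0) (by simp) (by simp)
    · exact h.joinedIn_drawnOn (hXZ 0) (by simp) (by simp)
    · exact h.joinedIn_drawnOn (hXX 1 2 (by decide)) (by simp) (by simp)
    · exact (h.joinedIn_drawnOn (hXY 1) (by simp) (by simp)).trans
        (h.joinedIn_drawnOn (hYY 1 0 (by decide)) (by simp) (by simp))
    · exact (h.joinedIn_drawnOn (hXZ 1) (by simp) (by simp)).trans
        (h.joinedIn_drawnOn (hZZ 1 0 (by decide)) (by simp) (by simp))
    · exact (h.joinedIn_drawnOn (hXY 2) (by simp) (by simp)).trans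
        (h.joinedIn_drawnOn (hYY 2 0 (by decide)) (by simp) (by simp))
    · exact (h.joinedIn_drawnOn (hXZ 2) (by simp) (by simp)).trans
        (h.joinedIn_drawnOn (hZZ 2 0 (by decide)) (by simp) (by simp))
    · exact h34
  · have : ∀ a b c d : Fin 5, a < b → c < d → a < c → a ≠ d → b ≠ c → b ≠ d →
        (a, b, c, d) ∈ [((0 : Fin 5), (1 : Fin 5), (2 : Fin 5), (3 : Fin 5)), (0, 1, 2, 4),
        (0, 1, 3, 4), (0, 2, 1, 3), (0, 2, 1, 4), (0, 2, 3, 4), (0, 3, 1, 2), (0, 3, 1, 4),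
        (0, 3, 2, 4), (0, 4, 1, 2), (0, 4, 1, 3), (0, 4, 2, 3), (1, 2, 3, 4), (1, 3, 2, 4),
        (1, 4, 2, 3)] := by decide
    intro a b c d h1 h2 h3 h4 h5 h6
    have := this a b c d h1 h2 h3 h4 h5 h6
    simp only [List.mem_cons, Prod.mk.injEq, List.not_mem_nil, or_false] at this
    rcases this with ⟨rfl, rfl, rfl, rfl⟩ | ⟨rfl, rfl, rfl, rfl⟩ | ⟨rfl, rfl, rfl, rfl⟩ |
      ⟨rfl, rfl, rfl, rfl⟩ | ⟨rfl, rfl, rfl, rfl⟩ | ⟨rfl, rfl, rfl, rfl⟩ | ⟨rfl, rfl, rfl, rfl⟩ |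
      ⟨rfl, rfl, rfl, rfl⟩ | ⟨rfl, rfl, rfl, rfl⟩ | ⟨rfl, rfl, rfl, rfl⟩ | ⟨rfl, rfl, rfl, rfl⟩ |
      ⟨rfl, rfl, rfl, rfl⟩ | ⟨rfl, rfl, rfl, rfl⟩ | ⟨rfl, rfl, rfl, rfl⟩ | ⟨rfl, rfl, rfl, rfl⟩
    all_goals first
      | exact hDL _ _
      | exact hDisj _ _ (by simp [Set.disjoint_left, X, Y, Z])

theorem IsSphereOfDim.exists_dist_eq {d l : ℕ} {S : Set (EuclideanSpace ℝ (Fin d))}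
    (h : IsSphereOfDim l S) : ∃ c r, ∀ x ∈ S, dist x c = r := by
  obtain ⟨A, c, r, -, -, -, rfl⟩ := h
  exact ⟨c, r, fun x hx => hx.2⟩

theorem IsSphereOfDim.affineIndependent {d l : ℕ} {S : Set (EuclideanSpace ℝ (Fin d))}
    (h : IsSphereOfDim l S) {x y z : EuclideanSpace ℝ (Fin d)} (hx : x ∈ S) (hy : y ∈ S)
    (hz : z ∈ S) (hxy : x ≠ y) (hxz : x ≠ z) (hyz : y ≠ z) :
    AffineIndependent ℝ ![x, y, z] := by
  obtain ⟨c, r, hc⟩ := h.exists_dist_eq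
  refine EuclideanGeometry.Cospherical.affineIndependent_of_ne ⟨c, r, ?_⟩ hxy hxz hyz
  rintro w (rfl | rfl | rfl)
  exacts [hc _ hx, hc _ hy, hc _ hz]

/-- The i - 2 intermediate triangles give distinct collinear points on the circles, and three
distinct points of a circle are never collinear. -/
theorem le_of_hasSphericalCover {i k : ℕ} (h : HasSphericalCover 1 2 k (nestedTriangles i)) :
    i ≤ 2 * k + 2 := by
  obtain ⟨pos, arc, S, hdr, hS, hpos, harc⟩ := h
  by_contra hcon
  have hx : ∀ j : Fin (i - 2), ∃ x ∈ segment ℝ (pos (0, ⟨0, by omega⟩)) (pos (0, ⟨i - 1, by omega⟩)),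
      x ∈ drawnOn (nestedTriangles i) arc {v | v.2.val = j.val + 1} := fun j =>
    hdr.segment_meets_triangle (by omega)
  choose x hxs hxd using hx
  have hinj : Function.Injective x := by
    intro j j' hjj
    by_contra hne
    refine Set.disjoint_left.1 (hdr.1.disjoint_drawnOn (Set.disjoint_left.2 ?_)) (hxd j)
      (hjj ▸ hxd j')
    intro v hv hv'
    simp only [Set.mem_ofPred_eq] at hv hv'
    omega
  have hcov : ∀ j, ∃ m, x j ∈ S m := by
    intro j
    obtain ⟨e, he, -, hxe⟩ := hxd j
    exact Set.mem_iUnion.1 (harc e he hxe)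
  choose σ hσ using hcov
  have hfib : ∀ m ∈ Finset.univ.image σ, (Finset.univ.filter fun j => σ j = m).card ≤ 2 := by
    intro m _
    by_contra hc
    obtain ⟨a, b, c, ha, hb, hc, hab, hac, hbc⟩ := Finset.two_lt_card_iff.1 (not_le.1 hc)
    simp only [Finset.mem_filter, Finset.mem_univ, true_and] at ha hb hc
    have hind := (hS m).affineIndependent (ha ▸ hσ a) (hb ▸ hσ b) (hc ▸ hσ c) (hinj.ne hab)
      (hinj.ne hac) (hinj.ne hbc)
    rw [affineIndependent_iff_not_collinear_set] at hind
    have hline : ∀ j, x j ∈ line[ℝ, pos (0, ⟨0, by omega⟩), pos (0, ⟨i - 1, by omega⟩)] := by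
      intro j
      refine convexHull_subset_affineSpan _ ?_
      rw [convexHull_pair]
      exact hxs j
    exact hind (collinear_triple_of_mem_affineSpan_pair (hline a) (hline b) (hline c))
  have h1 := Finset.card_le_mul_card_image (s := Finset.univ) (f := σ) 2 hfib
  have h2 := Finset.card_le_univ (Finset.univ.image σ)
  simp only [Finset.card_univ, Fintype.card_fin] at h1 h2
  omega

/-! ### Circles and inversion -/

theorem exists_isSphereOfDim_one {d : ℕ} (c : EuclideanSpace ℝ (Fin d))
    {u v : EuclideanSpace ℝ (Fin d)} {r : ℝ} (hu : ‖u‖ = 1) (hv : ‖v‖ = 1)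
    (huv : inner ℝ u v = 0) (hr : 0 < r) :
    ∃ S, IsSphereOfDim 1 S ∧
      ∀ θ : ℝ, c + (r * Real.cos θ) • u + (r * Real.sin θ) • v ∈ S := by
  refine ⟨_, ⟨AffineSubspace.mk' c (Submodule.span ℝ {u, v}), c, r, ?_,
    AffineSubspace.self_mem_mk' _ _, hr, rfl⟩, fun θ => ⟨?_, ?_⟩⟩
  · have ho : Orthonormal ℝ ![u, v] := by
      rw [orthonormal_vecCons_iff]
      refine ⟨hu, ?_, ?_⟩
      · intro j; fin_cases j; exact huv
      · rw [orthonormal_vecCons_iff]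
        exact ⟨hv, fun j => j.elim0, ⟨fun j => j.elim0, fun j => j.elim0⟩⟩
    have := finrank_span_eq_card ho.linearIndependent
    rw [AffineSubspace.direction_mk']
    have hr : Set.range ![u, v] = {u, v} := by simp [Set.pair_comm]
    rw [hr] at this
    simpa using this
  · rw [AffineSubspace.mem_mk', add_assoc, vsub_eq_sub, add_sub_cancel_left]
    exact Submodule.mem_span_pair.2 ⟨_, _, rfl⟩
  · rw [add_assoc, dist_eq_norm, add_sub_cancel_left]
    have h2 : ‖(r * Real.cos θ) • u + (r * Real.sin θ) • v‖ ^ 2 = r ^ 2 := by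
      rw [norm_add_sq_real, inner_smul_left, inner_smul_right, huv, norm_smul, norm_smul, hu, hv,
        mul_one, mul_one, Real.norm_eq_abs, Real.norm_eq_abs, sq_abs, sq_abs]
      simp only [mul_zero, add_zero]
      linear_combination r ^ 2 * Real.sin_sq_add_cos_sq θ
    exact (pow_left_inj₀ (norm_nonneg _) hr.le two_ne_zero).1 h2

theorem IsCircularArc.exists_sphere {d : ℕ} {K : Set (EuclideanSpace ℝ (Fin d))}
    {p q : EuclideanSpace ℝ (Fin d)} (h : IsCircularArc K p q) :
    ∃ S, IsSphereOfDim 1 S ∧ K ⊆ S := by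
  obtain ⟨c, u, v, r, α, β, hu, hv, huv, hr, -, -, -, -, rfl⟩ := h
  obtain ⟨S, hS, hm⟩ := exists_isSphereOfDim_one c hu hv huv hr
  refine ⟨S, hS, ?_⟩
  rintro _ ⟨θ, -, rfl⟩
  exact hm θ

/-- Inversion in the unit sphere around the origin. -/
noncomputable def unitInversion {d : ℕ} (x : EuclideanSpace ℝ (Fin d)) :
    EuclideanSpace ℝ (Fin d) := (‖x‖ ^ 2)⁻¹ • x

theorem unitInversion_unitInversion {d : ℕ} (x : EuclideanSpace ℝ (Fin d)) :
    unitInversion (unitInversion x) = x := by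
  rcases eq_or_ne x 0 with rfl | hx
  -- Since `0⁻¹ = 0`, the origin is fixed; inversion is thus an involution of the whole space.
  · simp [unitInversion]
  · have : ‖x‖ ≠ 0 := norm_ne_zero_iff.2 hx
    rw [unitInversion, unitInversion, smul_smul, norm_smul, Real.norm_eq_abs, mul_pow, sq_abs]
    convert one_smul ℝ x using 2
    field_simp

theorem unitInversion_injective {d : ℕ} :
    Function.Injective (unitInversion : EuclideanSpace ℝ (Fin d) → _) :=
  (Function.Involutive.injective unitInversion_unitInversion)

/-- `h • e` is the foot of the perpendicular from the origin, nonzero because the line misses the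
origin; `f` is the unit direction. -/
theorem line_normal_form {d : ℕ} {b D : EuclideanSpace ℝ (Fin d)} (hD : D ≠ 0)
    (h0 : ∀ t : ℝ, b + t • D ≠ 0) :
    ∃ (e f : EuclideanSpace ℝ (Fin d)) (h μ ν : ℝ), ‖e‖ = 1 ∧ ‖f‖ = 1 ∧ inner ℝ e f = 0 ∧ 0 < h ∧
      0 < μ ∧ ∀ t : ℝ, b + t • D = h • e + (μ * t + ν) • f := by
  have hD' : ‖D‖ ≠ 0 := norm_ne_zero_iff.2 hD
  set f := ‖D‖⁻¹ • D with hf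
  have hfn : ‖f‖ = 1 := by rw [hf, norm_smul, norm_inv, norm_norm, inv_mul_cancel₀ hD']
  set ν := inner ℝ b f with hν
  set w := b - ν • f with hw
  have hDf : D = ‖D‖ • f := by rw [hf, smul_smul, mul_inv_cancel₀ hD', one_smul]
  have hw0 : w ≠ 0 := by
    have := h0 (-(ν * ‖D‖⁻¹))
    rwa [neg_smul, ← smul_smul, ← sub_eq_add_neg] at this
  have hwn : ‖w‖ ≠ 0 := norm_ne_zero_iff.2 hw0
  refine ⟨‖w‖⁻¹ • w, f, ‖w‖, ‖D‖, ν, ?_, hfn, ?_, by positivity, by positivity, fun t => ?_⟩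
  · rw [norm_smul, norm_inv, norm_norm, inv_mul_cancel₀ hwn]
  · rw [inner_smul_left, hw, inner_sub_left, inner_smul_left, real_inner_self_eq_norm_sq, hfn]
    simp [← hν]
  · rw [smul_smul, mul_inv_cancel₀ hwn, one_smul, hw, add_smul, mul_comm, ← smul_smul, ← hDf]
    abel

/-- The image circle has the segment from 0 to `h⁻¹ • e` as diameter. The origin sees the point at
angle `arctan (x / h)`, and the central angle is twice that inscribed angle. -/
theorem unitInversion_line {d : ℕ} {e f : EuclideanSpace ℝ (Fin d)} {h : ℝ} (he : ‖e‖ = 1)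
    (hf : ‖f‖ = 1) (hef : inner ℝ e f = 0) (hh : 0 < h) (x : ℝ) :
    unitInversion (h • e + x • f) = (1 / (2 * h)) • e +
      (1 / (2 * h) * Real.cos (2 * Real.arctan (x / h))) • e +
      (1 / (2 * h) * Real.sin (2 * Real.arctan (x / h))) • f := by
  have hn : ‖h • e + x • f‖ ^ 2 = h ^ 2 + x ^ 2 := by
    rw [norm_add_sq_real, inner_smul_left, inner_smul_right, hef, norm_smul, norm_smul, he, hf,
      mul_one, mul_one, Real.norm_eq_abs, Real.norm_eq_abs, sq_abs, sq_abs]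
    simp
  have hpos : h ^ 2 + x ^ 2 ≠ 0 := by positivity
  have hc : Real.cos (2 * Real.arctan (x / h)) = 2 * (h ^ 2 / (h ^ 2 + x ^ 2)) - 1 := by
    rw [Real.cos_two_mul, Real.cos_sq_arctan]
    field_simp
  have hs : Real.sin (2 * Real.arctan (x / h)) = 2 * (h * x) / (h ^ 2 + x ^ 2) := by
    rw [Real.sin_two_mul, Real.sin_arctan, Real.cos_arctan]
    have h1 : (0 : ℝ) < 1 + (x / h) ^ 2 := by positivity
    have h2 := Real.mul_self_sqrt h1.le
    have h3 : √(1 + (x / h) ^ 2) ≠ 0 := (Real.sqrt_pos.2 h1).ne'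
    calc 2 * (x / h / √(1 + (x / h) ^ 2)) * (1 / √(1 + (x / h) ^ 2))
        = 2 * (x / h) / (√(1 + (x / h) ^ 2) * √(1 + (x / h) ^ 2)) := by field_simp
      _ = _ := by rw [h2]; field_simp
  rw [unitInversion, hn, hc, hs, smul_add, smul_smul, smul_smul, ← add_smul]
  congr 2 <;> field_simp
  ring

theorem unitInversion_line_subset_sphere {d : ℕ} {b D : EuclideanSpace ℝ (Fin d)} (hD : D ≠ 0)
    (h0 : ∀ t : ℝ, b + t • D ≠ 0) :
    ∃ S, IsSphereOfDim 1 S ∧ ∀ t : ℝ, unitInversion (b + t • D) ∈ S := by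
  obtain ⟨e, f, h, μ, ν, he, hf, hef, hh, -, hl⟩ := line_normal_form hD h0
  obtain ⟨S, hS, hm⟩ := exists_isSphereOfDim_one ((1 / (2 * h)) • e) he hf hef
    (r := 1 / (2 * h)) (by positivity)
  refine ⟨S, hS, fun t => ?_⟩
  rw [hl, unitInversion_line he hf hef hh]
  exact hm _

/-- The central angle is continuous and strictly increasing along the segment and stays in (-π, π),
so the image is an arc of less than a full turn. -/
theorem isCircularArc_unitInversion_segment {d : ℕ} {p q : EuclideanSpace ℝ (Fin d)} (hpq : p ≠ q)
    (h0 : ∀ t : ℝ, p + t • (q - p) ≠ 0) :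
    IsCircularArc (unitInversion '' segment ℝ p q) (unitInversion p) (unitInversion q) := by
  obtain ⟨e, f, h, μ, ν, he, hf, hef, hh, hμ, hl⟩ :=
    line_normal_form (sub_ne_zero.2 hpq.symm) h0
  let A : ℝ → ℝ := fun t => 2 * Real.arctan ((μ * t + ν) / h)
  have hA : StrictMono A := fun s t hst => by
    refine mul_lt_mul_of_pos_left (Real.arctan_strictMono ?_) two_pos
    gcongr
  have hAc : Continuous A := by fun_prop
  have hi : ∀ t, unitInversion (p + t • (q - p)) = (1 / (2 * h)) • e +
      (1 / (2 * h) * Real.cos (A t)) • e + (1 / (2 * h) * Real.sin (A t)) • f := fun t => by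
    rw [hl, unitInversion_line he hf hef hh]
  refine ⟨(1 / (2 * h)) • e, e, f, 1 / (2 * h), A 0, A 1, he, hf, hef, by positivity,
    hA one_pos, ?_, ?_, ?_, ?_⟩
  · have h1 := Real.neg_pi_div_two_lt_arctan ((μ * 0 + ν) / h)
    have h2 := Real.arctan_lt_pi_div_two ((μ * 1 + ν) / h)
    simp only [A]
    linarith
  · simpa using hi 0
  · simpa using hi 1
  · have himg : Set.Icc (A 0) (A 1) = A '' Set.Icc 0 1 := by
      apply Set.Subset.antisymm
      · exact intermediate_value_Icc zero_le_one hAc.continuousOn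
      · rintro _ ⟨t, ht, rfl⟩
        exact ⟨hA.monotone ht.1, hA.monotone ht.2⟩
    rw [segment_eq_image', himg, Set.image_image, Set.image_image]
    simp only [hi]

theorem IsCrossingFree.image {V : Type*} {d d' : ℕ} {G : SimpleGraph V}
    {pos : V → EuclideanSpace ℝ (Fin d)} {arc : Sym2 V → Set (EuclideanSpace ℝ (Fin d))}
    (h : IsCrossingFree G pos arc)
    {φ : EuclideanSpace ℝ (Fin d) → EuclideanSpace ℝ (Fin d')} (hφ : Function.Injective φ) :
    IsCrossingFree G (fun v => φ (pos v)) (fun e => φ '' arc e) := by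
  refine ⟨hφ.comp h.1, ?_, ?_⟩
  · rintro e he w ⟨x, hx, hxw⟩
    exact h.2.1 e he w (hφ hxw ▸ hx)
  · rintro e he f hf hne _ ⟨⟨x, hx, rfl⟩, ⟨y, hy, hyx⟩⟩
    obtain ⟨w, h1, h2, rfl⟩ := h.2.2 e he f hf hne x ⟨hx, hφ hyx ▸ hy⟩
    exact ⟨w, h1, h2, rfl⟩

/-- The straight-line segment representing an edge. -/
def segmentArc {V : Type*} {d : ℕ} (pos : V → EuclideanSpace ℝ (Fin d)) :
    Sym2 V → Set (EuclideanSpace ℝ (Fin d)) :=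
  Sym2.lift ⟨fun a b => segment ℝ (pos a) (pos b), fun _ _ => segment_symm _ _ _⟩

/-- A straight-line drawing on finitely many lines avoiding the origin becomes, under inversion, a
circular-arc drawing on as many circles. -/
theorem hasSphericalCover_of_lines {V ι : Type*} [Fintype ι] {d : ℕ} {G : SimpleGraph V}
    {pos : V → EuclideanSpace ℝ (Fin d)} (hcf : IsCrossingFree G pos (segmentArc pos))
    (b D : ι → EuclideanSpace ℝ (Fin d)) (hD : ∀ j, D j ≠ 0) (h0 : ∀ j, ∀ t : ℝ, b j + t • D j ≠ 0)
    (hv : ∀ v, ∃ j, ∃ t : ℝ, pos v = b j + t • D j)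
    (he : ∀ v w, G.Adj v w → ∃ j, ∃ s t : ℝ, pos v = b j + s • D j ∧ pos w = b j + t • D j) :
    HasSphericalCover 1 d (Fintype.card ι) G := by
  choose S hS hmem using fun j => unitInversion_line_subset_sphere (hD j) (h0 j)
  have hmem' : ∀ j, ∀ t : ℝ, unitInversion (b j + t • D j) ∈
      ⋃ m, S ((Fintype.equivFin ι).symm m) := fun j t =>
    Set.mem_iUnion.2 ⟨Fintype.equivFin ι j, by simpa using hmem j t⟩
  have hline : ∀ j (s t x : ℝ), b j + s • D j + x • (b j + t • D j - (b j + s • D j)) =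
      b j + (s + x * (t - s)) • D j := fun j s t x => by module
  refine ⟨fun v => unitInversion (pos v), fun e => unitInversion '' segmentArc pos e,
    fun m => S ((Fintype.equivFin ι).symm m), ⟨hcf.image unitInversion_injective, ?_⟩,
    fun m => hS _, ?_, ?_⟩
  · intro v w hvw
    obtain ⟨j, s, t, hs, ht⟩ := he v w hvw
    refine isCircularArc_unitInversion_segment (hcf.1.ne hvw.ne) fun x => ?_
    rw [hs, ht, hline]
    exact h0 j _
  · intro v
    obtain ⟨j, t, hj⟩ := hv v
    simp only [hj]
    exact hmem' j t
  · intro e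
    induction e with
    | h v w =>
      intro hvw
      obtain ⟨j, s, t, hs, ht⟩ := he v w hvw
      rintro _ ⟨x, hx, rfl⟩
      change x ∈ segment ℝ (pos v) (pos w) at hx
      rw [segment_eq_image'] at hx
      obtain ⟨y, -, rfl⟩ := hx
      simp only [hs, ht, hline]
      exact hmem' j _

theorem IsCircularArc.isSimpleArc {d : ℕ} {K : Set (EuclideanSpace ℝ (Fin d))}
    {p q : EuclideanSpace ℝ (Fin d)} (h : IsCircularArc K p q) : IsSimpleArc K p q := by
  obtain ⟨c, u, v, r, α, β, hu, hv, huv, hr, hαβ, hβ, rfl, rfl, rfl⟩ := h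
  have hvu : inner ℝ v u = 0 := by rw [real_inner_comm, huv]
  have huu : inner ℝ u u = (1 : ℝ) := by rw [real_inner_self_eq_norm_sq, hu, one_pow]
  have hvv : inner ℝ v v = (1 : ℝ) := by rw [real_inner_self_eq_norm_sq, hv, one_pow]
  refine ⟨fun t => c + (r * Real.cos (α + t * (β - α))) • u +
    (r * Real.sin (α + t * (β - α))) • v, by fun_prop, ?_, by simp, by simp, ?_⟩
  · intro s hs t ht hst
    simp only [add_assoc, add_right_inj] at hst
    have h1 := congrArg (fun x => inner ℝ u x) hst
    have h2 := congrArg (fun x => inner ℝ v x) hst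
    simp only [inner_add_right, inner_smul_right, huv, hvu, huu, hvv, mul_zero, mul_one, add_zero,
      zero_add, mul_eq_mul_left_iff, hr.ne', or_false] at h1 h2
    have h3 : (α + s * (β - α)) = α + t * (β - α) := by
      obtain ⟨n, hn⟩ := Real.Angle.angle_eq_iff_two_pi_dvd_sub.1
        (Real.Angle.cos_sin_inj h1 h2)
      have hs1 : s * (β - α) ≤ β - α := mul_le_of_le_one_left (by linarith) hs.2
      have ht1 : t * (β - α) ≤ β - α := mul_le_of_le_one_left (by linarith) ht.2
      have hs0 : 0 ≤ s * (β - α) := mul_nonneg hs.1 (by linarith)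
      have ht0 : 0 ≤ t * (β - α) := mul_nonneg ht.1 (by linarith)
      have hpi := Real.pi_pos
      have hn1 : (n : ℝ) < 1 := by nlinarith
      have hn2 : (-1 : ℝ) < n := by nlinarith
      have : n = 0 := by
        have a : n < 1 := by exact_mod_cast hn1
        have b : -1 < n := by exact_mod_cast hn2
        omega
      subst this
      simp at hn
      linarith
    have h4 : s * (β - α) = t * (β - α) := by linarith
    exact mul_right_cancel₀ (sub_pos.2 hαβ).ne' h4
  · have : Set.Icc α β = (fun t => α + t * (β - α)) '' Set.Icc 0 1 := by
      have := segment_eq_image' ℝ α β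
      rw [segment_eq_Icc hαβ.le] at this
      simpa using this
    rw [this, Set.image_image]

theorem HasSphericalCover.isPlanarGraph {V : Type*} {k : ℕ} {G : SimpleGraph V}
    (h : HasSphericalCover 1 2 k G) : IsPlanarGraph G := by
  obtain ⟨pos, arc, -, hdr, -⟩ := h
  exact ⟨pos, arc, hdr.1, fun a b hab => (hdr.2 a b hab).isSimpleArc⟩

/-! ### Adding edges in space, one circle each -/

/-- Two different planes of the pencil around the axis `b 0` share only that axis, which is too
small to contain `U`. -/
theorem OrthonormalBasis.subsingleton_pencil {E : Type*} [NormedAddCommGroup E]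
    [InnerProductSpace ℝ E] (b : OrthonormalBasis (Fin 3) ℝ E) {U : Submodule ℝ E}
    (hU : Module.finrank ℝ U = 2) :
    {φ : ℝ | ∀ w ∈ U, inner ℝ (b 2) w = φ * inner ℝ (b 1) w}.Subsingleton := by
  intro φ hφ φ' hφ'
  by_contra hne
  have : U ≤ Submodule.span ℝ {b 0} := by
    intro w hw
    have h1 : inner ℝ (b 1) w = 0 := by
      have := (hφ w hw).symm.trans (hφ' w hw)
      have h : (φ - φ') * inner ℝ (b 1) w = 0 := by linear_combination this
      exact (mul_eq_zero.1 h).resolve_left (sub_ne_zero.2 hne)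
    have h2 : inner ℝ (b 2) w = 0 := by rw [hφ w hw, h1, mul_zero]
    have := b.sum_repr' w
    rw [Fin.sum_univ_three, h1, h2, zero_smul, zero_smul, add_zero, add_zero] at this
    exact Submodule.mem_span_singleton.2 ⟨_, this⟩
  have h1 := Submodule.finrank_mono this
  have h2 := finrank_span_le_card (R := ℝ) ({b 0} : Set E)
  simp only [Set.toFinset_singleton, Finset.card_singleton] at h2
  omega

theorem IsSphereOfDim.exists_direction {d : ℕ} {S : Set (EuclideanSpace ℝ (Fin d))}
    (h : IsSphereOfDim 1 S) :
    ∃ U : Submodule ℝ (EuclideanSpace ℝ (Fin d)), Module.finrank ℝ U = 2 ∧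
      ∀ x ∈ S, ∀ y ∈ S, ∀ z ∈ S, x ≠ y → x ≠ z → y ≠ z →
        U = vectorSpan ℝ (Set.range ![x, y, z]) := by
  obtain ⟨A, c, r, hA, hc, hr, rfl⟩ := id h
  refine ⟨A.direction, hA, fun x hx y hy z hz hxy hxz hyz => ?_⟩
  have hind := h.affineIndependent hx hy hz hxy hxz hyz
  symm
  have : FiniteDimensional ℝ A.direction := inferInstance
  refine hind.vectorSpan_eq_of_le_of_card_eq_finrank_add_one ?_ (by simp [hA])
  have hmem : ∀ k, ![x, y, z] k ∈ A := by
    intro k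
    fin_cases k
    exacts [hx.1, hy.1, hz.1]
  rw [vectorSpan_def, Submodule.span_le]
  rintro _ ⟨_, ⟨k, rfl⟩, _, ⟨l, rfl⟩, rfl⟩
  exact AffineSubspace.vsub_mem_direction (hmem k) (hmem l)

/-- A generic plane of the pencil through a line meets finitely many circles in finitely many
points. -/
theorem exists_plane_inter_finite {k : ℕ} {S : Fin k → Set (EuclideanSpace ℝ (Fin 3))}
    (hS : ∀ j, IsSphereOfDim 1 (S j)) (b : OrthonormalBasis (Fin 3) ℝ (EuclideanSpace ℝ (Fin 3)))
    (m : EuclideanSpace ℝ (Fin 3)) :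
    ∃ φ : ℝ, {x | x ∈ ⋃ j, S j ∧ inner ℝ (b 2) (x - m) = φ * inner ℝ (b 1) (x - m)}.Finite := by
  choose U hU hspan using fun j => (hS j).exists_direction
  -- A plane containing three points of a circle contains the directions `U j` of the circle's
  -- plane, so at most one slope per circle has to be avoided.
  have hbad : (⋃ j, {φ : ℝ | ∀ w ∈ U j, inner ℝ (b 2) w = φ * inner ℝ (b 1) w}).Finite :=
    Set.finite_iUnion fun j => (b.subsingleton_pencil (hU j)).finite
  obtain ⟨φ, hφ⟩ := hbad.exists_notMem
  refine ⟨φ, ?_⟩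
  have : {x | x ∈ ⋃ j, S j ∧ inner ℝ (b 2) (x - m) = φ * inner ℝ (b 1) (x - m)} =
      ⋃ j, {x | x ∈ S j ∧ inner ℝ (b 2) (x - m) = φ * inner ℝ (b 1) (x - m)} := by
    ext x; simp
  rw [this]
  refine Set.finite_iUnion fun j => ?_
  by_contra hinf
  obtain ⟨t, hts, htc⟩ := Set.Infinite.exists_subset_card_eq hinf 3
  obtain ⟨x, y, z, hxy, hxz, hyz, rfl⟩ := Finset.card_eq_three.1 htc
  have hx := hts (by simp : x ∈ _)
  have hy := hts (by simp : y ∈ _)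
  have hz := hts (by simp : z ∈ _)
  refine hφ (Set.mem_iUnion.2 ⟨j, ?_⟩)
  let ℓ : EuclideanSpace ℝ (Fin 3) →ₗ[ℝ] ℝ :=
    (innerₗ (EuclideanSpace ℝ (Fin 3)) (b 2)) - φ • (innerₗ (EuclideanSpace ℝ (Fin 3)) (b 1))
  have hℓ : ∀ w, ℓ w = inner ℝ (b 2) w - φ * inner ℝ (b 1) w := fun w => rfl
  have hℓ0 : ∀ k, ℓ (![x, y, z] k) = ℓ m := by
    have : ∀ w, inner ℝ (b 2) (w - m) = φ * inner ℝ (b 1) (w - m) → ℓ w = ℓ m := by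
      intro w hw
      rw [← sub_eq_zero, ← map_sub, hℓ, hw, sub_self]
    intro k; fin_cases k
    exacts [this _ hx.2, this _ hy.2, this _ hz.2]
  have hle : U j ≤ LinearMap.ker ℓ := by
    rw [hspan j x hx.1 y hy.1 z hz.1 hxy hxz hyz, vectorSpan_def, Submodule.span_le]
    rintro _ ⟨_, ⟨k, rfl⟩, _, ⟨l, rfl⟩, rfl⟩
    simp [hℓ0]
  intro w hw
  have := hle hw
  rw [LinearMap.mem_ker, hℓ] at this
  linarith

/-- Two points can be joined by a circular arc that meets finitely many given circles only in its
endpoints. -/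
theorem exists_isCircularArc_inter_subset {k : ℕ} {S : Fin k → Set (EuclideanSpace ℝ (Fin 3))}
    (hS : ∀ j, IsSphereOfDim 1 (S j)) {p q : EuclideanSpace ℝ (Fin 3)} (hpq : p ≠ q) :
    ∃ K, IsCircularArc K p q ∧ ∀ x ∈ K, x ∈ ⋃ j, S j → x = p ∨ x = q := by
  have hd : ‖q - p‖ ≠ 0 := norm_ne_zero_iff.2 (sub_ne_zero.2 hpq.symm)
  set h := ‖q - p‖ / 2 with hh
  have hpos : 0 < h := by positivity
  obtain ⟨b, hb⟩ := Orthonormal.exists_orthonormalBasis_extension_of_card_eq (𝕜 := ℝ)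
    (E := EuclideanSpace ℝ (Fin 3)) (ι := Fin 3) (by simp)
    (v := fun _ => ‖q - p‖⁻¹ • (q - p)) (s := {0})
    ⟨fun _ => by simp only [Set.domRestrict_apply, norm_smul, norm_inv, norm_norm, inv_mul_cancel₀ hd],
      fun i j hij => (hij (Subsingleton.elim i j)).elim⟩
  have hb0 : b 0 = ‖q - p‖⁻¹ • (q - p) := hb 0 rfl
  set m := p + h • b 0 with hm
  have hq : q = m + h • b 0 := by
    have : (2 * h) • b 0 = q - p := by
      rw [hb0, smul_smul, hh, mul_div_cancel₀ _ (two_ne_zero), mul_inv_cancel₀ hd, one_smul]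
    have : q = p + (2 * h) • b 0 := by rw [this]; abel
    rw [this, hm]; module
  have hp : p = m - h • b 0 := by rw [hm]; abel
  obtain ⟨φ, hfin⟩ := exists_plane_inter_finite hS b m
  have h11 : ∀ i, inner ℝ (b i) (b i) = (1 : ℝ) := fun i => by simp
  have h01 : inner ℝ (b 0) (b 1) = (0 : ℝ) := b.orthonormal.2 (by decide)
  have h02 : inner ℝ (b 0) (b 2) = (0 : ℝ) := b.orthonormal.2 (by decide)
  have h12 : inner ℝ (b 1) (b 2) = (0 : ℝ) := b.orthonormal.2 (by decide)
  have h21 : inner ℝ (b 2) (b 1) = (0 : ℝ) := b.orthonormal.2 (by decide)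
  have h10 : inner ℝ (b 1) (b 0) = (0 : ℝ) := b.orthonormal.2 (by decide)
  have h20 : inner ℝ (b 2) (b 0) = (0 : ℝ) := b.orthonormal.2 (by decide)
  set e' := b 1 + φ • b 2 with he'
  have he'0 : ‖e'‖ ≠ 0 := by
    rw [norm_ne_zero_iff]
    intro h
    have := congrArg (fun x => inner ℝ (b 1) x) h
    simp [he', inner_add_right, inner_smul_right, h12] at this
  set e := ‖e'‖⁻¹ • e' with he
  have hen : ‖e‖ = 1 := by rw [he, norm_smul, norm_inv, norm_norm, inv_mul_cancel₀ he'0]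
  have hee : inner ℝ e e = (1 : ℝ) := by rw [real_inner_self_eq_norm_sq, hen, one_pow]
  have heb : inner ℝ e (b 0) = (0 : ℝ) := by
    rw [he, he', inner_smul_left, inner_add_left, inner_smul_left, h10, h20]; simp
  have hbe : inner ℝ (b 0) e = (0 : ℝ) := by rw [real_inner_comm, heb]
  have hpl : inner ℝ (b 2) e = φ * inner ℝ (b 1) e := by
    rw [he, he', inner_smul_right, inner_add_right, inner_smul_right, h21, h11, inner_smul_right,
      inner_add_right, inner_smul_right, h12, h11]; ring
  clear_value e
  -- In the chosen plane, spanned at `m` by `e` and `b 0`, `C ψ` runs through the circle through `p`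
  -- and `q` with radius `h / sin ψ`; θ = -ψ gives `p` and θ = ψ gives `q`.
  let C : ℝ → ℝ → EuclideanSpace ℝ (Fin 3) := fun ψ θ =>
    m - (h * Real.cos ψ / Real.sin ψ) • e + (h / Real.sin ψ * Real.cos θ) • e +
      (h / Real.sin ψ * Real.sin θ) • b 0
  have hC : ∀ ψ θ, C ψ θ - m = (h * (Real.cos θ - Real.cos ψ) / Real.sin ψ) • e +
      (h * Real.sin θ / Real.sin ψ) • b 0 := fun ψ θ => by
    simp only [C]
    rw [show h * (Real.cos θ - Real.cos ψ) / Real.sin ψ =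
      h / Real.sin ψ * Real.cos θ - h * Real.cos ψ / Real.sin ψ by ring,
      show h * Real.sin θ / Real.sin ψ = h / Real.sin ψ * Real.sin θ by ring]
    module
  have hCe : ∀ ψ θ, inner ℝ e (C ψ θ - m) = h * (Real.cos θ - Real.cos ψ) / Real.sin ψ :=
    fun ψ θ => by
      rw [hC, inner_add_right, inner_smul_right, inner_smul_right, hee, heb]; ring
  have hCb : ∀ ψ θ, inner ℝ (b 0) (C ψ θ - m) = h * Real.sin θ / Real.sin ψ :=
    fun ψ θ => by
      rw [hC, inner_add_right, inner_smul_right, inner_smul_right, hbe, h11]; ring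
  have hCpl : ∀ ψ θ, inner ℝ (b 2) (C ψ θ - m) = φ * inner ℝ (b 1) (C ψ θ - m) := fun ψ θ => by
    rw [hC, inner_add_right, inner_smul_right, inner_smul_right, inner_add_right,
      inner_smul_right, inner_smul_right, h10, h20, hpl]; ring
  have hends : ∀ ψ θ, 0 < Real.sin ψ → Real.cos θ = Real.cos ψ → C ψ θ = p ∨ C ψ θ = q := by
    intro ψ θ hψ hcos
    have hs : Real.sin θ ^ 2 = Real.sin ψ ^ 2 := by
      rw [Real.sin_sq, Real.sin_sq, hcos]
    have hCm : C ψ θ = m + (C ψ θ - m) := by abel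
    rcases sq_eq_sq_iff_eq_or_eq_neg.1 hs with h1 | h1
    · right
      rw [hCm, hC, hcos, h1, hq, sub_self, mul_zero, zero_div, zero_smul, zero_add,
        mul_div_cancel_right₀ _ hψ.ne']
    · left
      rw [hCm, hC, hcos, h1, hp, sub_self, mul_zero, zero_div, zero_smul, zero_add, mul_neg,
        neg_div, mul_div_cancel_right₀ _ hψ.ne', neg_smul]
      abel
  let bad : EuclideanSpace ℝ (Fin 3) → Set ℝ := fun x =>
    {ψ | ψ ∈ Set.Ioo 0 Real.pi ∧ x ≠ p ∧ x ≠ q ∧ ∃ θ, x = C ψ θ}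
  -- The equation of `C ψ` is affine in `cot ψ` with coefficient `2 * h * ⟪e, x - m⟫`, nonzero
  -- unless `x` is `p` or `q`. So any other point lies on at most one of these circles, and the
  -- finitely many points of the plane on given circles exclude finitely many ψ.
  have hbad : ∀ x, (bad x).Subsingleton := by
    rintro x ψ ⟨hψ, hxp, hxq, θ, hx⟩ ψ' ⟨hψ', -, -, θ', hx'⟩
    have hs := Real.sin_pos_of_pos_of_lt_pi hψ.1 hψ.2
    have hs' := Real.sin_pos_of_pos_of_lt_pi hψ'.1 hψ'.2
    have hY : inner ℝ e (x - m) ≠ 0 := by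
      intro h0
      rw [hx, hCe, div_eq_zero_iff, mul_eq_zero] at h0
      have : Real.cos θ = Real.cos ψ := by
        rcases h0 with (h0 | h0) | h0
        · exact (hpos.ne' h0).elim
        · linarith
        · exact (hs.ne' h0).elim
      rcases hends ψ θ hs this with h | h
      · exact hxp (hx.trans h)
      · exact hxq (hx.trans h)
    have key : ∀ ψ θ, 0 < Real.sin ψ → x = C ψ θ →
        inner ℝ (b 0) (x - m) ^ 2 + inner ℝ e (x - m) ^ 2 +
          2 * h * inner ℝ e (x - m) * (Real.cos ψ / Real.sin ψ) = h ^ 2 := by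
      intro ψ θ hs hx
      rw [hx, hCe, hCb]
      field_simp
      have e1 := Real.sin_sq_add_cos_sq θ
      have e2 := Real.sin_sq_add_cos_sq ψ
      linear_combination e1 - e2
    have e1 := key ψ θ hs hx
    have e2 := key ψ' θ' hs' hx'
    have e3 : Real.cos ψ / Real.sin ψ = Real.cos ψ' / Real.sin ψ' := by
      have : 2 * h * inner ℝ e (x - m) ≠ 0 := mul_ne_zero (by positivity) hY
      exact mul_left_cancel₀ this (by linarith)
    rw [div_eq_div_iff hs.ne' hs'.ne'] at e3
    have e4 : Real.sin (ψ' - ψ) = 0 := by rw [Real.sin_sub]; linarith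
    have := (Real.sin_eq_zero_iff_of_lt_of_lt (by linarith [hψ.1, hψ.2, hψ'.1, hψ'.2])
      (by linarith [hψ.1, hψ.2, hψ'.1, hψ'.2])).1 e4
    linarith
  obtain ⟨ψ, hψ, hgood⟩ := (Set.Ioo_infinite Real.pi_pos).exists_notMem_finite
    (hfin.biUnion fun x _ => (hbad x).finite)
  have hs := Real.sin_pos_of_pos_of_lt_pi hψ.1 hψ.2
  have hsym : h / Real.sin ψ * Real.sin ψ = h := div_mul_cancel₀ _ hs.ne'
  refine ⟨C ψ '' Set.Icc (-ψ) ψ, ⟨m - (h * Real.cos ψ / Real.sin ψ) • e, e, b 0, h / Real.sin ψ,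
    -ψ, ψ, hen, by simp, heb, by positivity, by linarith [hψ.1], by linarith [hψ.2], ?_, ?_, rfl⟩,
    ?_⟩
  · rw [Real.cos_neg, Real.sin_neg, mul_neg, hsym, hp, div_mul_eq_mul_div]; module
  · rw [hsym, hq, div_mul_eq_mul_div]; module
  · rintro x ⟨θ, -, rfl⟩ hx
    by_contra hne
    rw [not_or] at hne
    exact hgood (Set.mem_biUnion (show C ψ θ ∈ _ from ⟨hx, hCpl ψ θ⟩) ⟨hψ, hne.1, hne.2, θ, rfl⟩)

theorem IsCircularArc.symm {d : ℕ} {K : Set (EuclideanSpace ℝ (Fin d))}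
    {p q : EuclideanSpace ℝ (Fin d)} (h : IsCircularArc K p q) : IsCircularArc K q p := by
  obtain ⟨c, u, v, r, α, β, hu, hv, huv, hr, hαβ, hβ, rfl, rfl, rfl⟩ := h
  refine ⟨c, u, -v, r, -β, -α, hu, by rwa [norm_neg], by rw [inner_neg_right, huv, neg_zero], hr,
    by linarith, by linarith, ?_, ?_, ?_⟩
  · simp
  · simp
  · rw [← Set.image_neg_Icc, Set.image_image]
    simp

/-- The new arc touches the old circles only at its ends, hence crosses no old arc. If `uv` is
already an edge, it is simply redrawn. -/
theorem HasSphericalCover.sup_edge {V : Type*} {k : ℕ} {G : SimpleGraph V}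
    (h : HasSphericalCover 1 3 k G) {u v : V} (huv : u ≠ v) :
    HasSphericalCover 1 3 (k + 1) (G ⊔ SimpleGraph.edge u v) := by
  classical
  obtain ⟨pos, arc, S, ⟨⟨hinj, hvert, hcross⟩, harc⟩, hS, hpos, hcov⟩ := h
  obtain ⟨K, hK, hKS⟩ := exists_isCircularArc_inter_subset hS (hinj.ne huv)
  obtain ⟨S', hS', hKS'⟩ := hK.exists_sphere
  have hedge : ∀ e ∈ (G ⊔ SimpleGraph.edge u v).edgeSet, e ≠ s(u, v) → e ∈ G.edgeSet := by
    intro e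
    induction e with
    | h a b =>
      intro he hne
      rw [SimpleGraph.mem_edgeSet, SimpleGraph.sup_adj, SimpleGraph.edge_adj] at he
      rcases he with he | ⟨he, -⟩
      · exact he
      · exact (hne (Sym2.eq_iff.2 he)).elim
  have hsub : ⋃ j, S j ⊆ ⋃ j, (Fin.cons S' S : Fin (k + 1) → _) j := by
    refine Set.iUnion_subset fun j => ?_
    exact Set.subset_iUnion_of_subset j.succ (by simp)
  have hKw : ∀ e ∈ G.edgeSet, e ≠ s(u, v) → ∀ x ∈ K, x ∈ arc e →
      ∃ w, w ∈ s(u, v) ∧ w ∈ e ∧ x = pos w := by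
    intro e he hne x hxK hxe
    rcases hKS x hxK (hcov e he hxe) with rfl | rfl
    · exact ⟨u, by simp, hvert e he u hxe, rfl⟩
    · exact ⟨v, by simp, hvert e he v hxe, rfl⟩
  refine ⟨pos, fun e => if e = s(u, v) then K else arc e, Fin.cons S' S,
    ⟨⟨hinj, ?_, ?_⟩, ?_⟩, ?_, fun w => hsub (hpos w), ?_⟩
  · intro e he w hw
    dsimp only at hw
    by_cases hne : e = s(u, v)
    · rw [if_pos hne] at hw
      rw [hne, Sym2.mem_iff]
      -- All vertices, even isolated ones, lie on the old circles; this is what keeps the new arc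
      -- off them.
      exact (hKS _ hw (hpos w)).imp (fun h => hinj h) (fun h => hinj h)
    · rw [if_neg hne] at hw
      exact hvert e (hedge e he hne) w hw
  · rintro e he f hf hef x ⟨hxe, hxf⟩
    dsimp only at hxe hxf
    by_cases hne : e = s(u, v)
    · have hnf : f ≠ s(u, v) := fun h => hef (hne.trans h.symm)
      rw [if_pos hne] at hxe
      rw [if_neg hnf] at hxf
      rw [hne]
      exact hKw f (hedge f hf hnf) hnf x hxe hxf
    · rw [if_neg hne] at hxe
      by_cases hnf : f = s(u, v)
      · rw [if_pos hnf] at hxf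
        obtain ⟨w, h1, h2, h3⟩ := hKw e (hedge e he hne) hne x hxf hxe
        exact ⟨w, h2, hnf ▸ h1, h3⟩
      · rw [if_neg hnf] at hxf
        exact hcross e (hedge e he hne) f (hedge f hf hnf) hef x ⟨hxe, hxf⟩
  · intro a b hab
    by_cases hne : s(a, b) = s(u, v)
    · simp only [if_pos hne]
      rcases Sym2.eq_iff.1 hne with ⟨rfl, rfl⟩ | ⟨rfl, rfl⟩
      · exact hK
      · exact hK.symm
    · simp only [if_neg hne]
      exact harc a b (hedge s(a, b) hab hne)
  · intro j
    refine Fin.cases ?_ (fun j => ?_) j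
    · simpa using hS'
    · simpa using hS j
  · intro e he
    by_cases hne : e = s(u, v)
    · simp only [if_pos hne]
      exact Set.subset_iUnion_of_subset 0 (by simpa using hKS')
    · simp only [if_neg hne]
      exact (hcov e (hedge e he hne)).trans hsub

theorem HasSphericalCover.sup_edges {V : Type*} {k : ℕ} {G : SimpleGraph V}
    (h : HasSphericalCover 1 3 k G) (F : Finset (V × V)) (hF : ∀ p ∈ F, p.1 ≠ p.2) :
    HasSphericalCover 1 3 (k + F.card) (G ⊔ F.sup fun p => SimpleGraph.edge p.1 p.2) := by
  classical
  induction F using Finset.induction_on with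
  | empty => simpa using h
  | insert p F hp ih =>
    have := (ih fun q hq => hF q (Finset.mem_insert_of_mem hq)).sup_edge
      (hF p (Finset.mem_insert_self p F))
    rw [Finset.card_insert_of_notMem hp, Finset.sup_insert, sup_comm (SimpleGraph.edge p.1 p.2),
      ← sup_assoc]
    exact this

/-! ### Cutting the nested triangles into blocks -/

/-- The nested triangles with the spoke edges between different blocks of `N` consecutive levels
removed. -/
def blockTriangles (N i : ℕ) : SimpleGraph (Fin 3 × Fin i) where
  Adj a b := (nestedTriangles i).Adj a b ∧ a.2.val / N = b.2.val / N
  symm := ⟨fun _ _ h => ⟨h.1.symm, h.2.symm⟩⟩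
  loopless := ⟨fun a h => (nestedTriangles i).loopless.irrefl a h.1⟩

theorem HasSphericalCover.nestedTriangles_of_block {N i k : ℕ} (hi : i ≤ N ^ 3)
    (h : HasSphericalCover 1 3 k (blockTriangles N i)) :
    ∃ m ≤ k + 3 * N ^ 2, HasSphericalCover 1 3 m (nestedTriangles i) := by
  classical
  let F : Finset ((Fin 3 × Fin i) × (Fin 3 × Fin i)) := Finset.univ.filter fun p =>
    p.1.1 = p.2.1 ∧ p.1.2.val + 1 = p.2.2.val ∧ p.1.2.val / N ≠ p.2.2.val / N
  have hF : ∀ p, p ∈ F ↔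
      p.1.1 = p.2.1 ∧ p.1.2.val + 1 = p.2.2.val ∧ p.1.2.val / N ≠ p.2.2.val / N := by
    intro p; simp [F]
  have hcard : F.card ≤ 3 * N ^ 2 := by
    have hle := Finset.card_le_card_of_injOn (s := F)
      (t := (Finset.univ : Finset (Fin 3)) ×ˢ Finset.range (N ^ 2))
      (fun p => (p.2.1, p.2.2.val / N)) ?_ ?_
    · simpa using hle
    · intro p hp
      simp only [Finset.coe_product, Finset.coe_univ, Finset.coe_range, Set.mem_prod,
        Set.mem_univ, Set.mem_Iio, true_and]
      refine Nat.div_lt_of_lt_mul (lt_of_lt_of_le p.2.2.isLt (hi.trans_eq (by ring)))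
    · intro p hp p' hp' hpp
      obtain ⟨h1, h2, h3⟩ := (hF p).1 hp
      obtain ⟨h1', h2', h3'⟩ := (hF p').1 hp'
      simp only [Prod.mk.injEq] at hpp
      -- The quotient jumps only at multiples of `N`, so a removed edge is determined by its spoke
      -- and the block of its upper end.
      have dvd : ∀ x y : ℕ, x + 1 = y → x / N ≠ y / N → y = N * (y / N) := by
        rintro x _ rfl hne
        refine (Nat.mul_div_cancel' ?_).symm
        by_contra hnd
        exact hne (by rw [Nat.succ_div_of_not_dvd hnd])
      have e1 := dvd _ _ h2 h3
      have e2 := dvd _ _ h2' h3'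
      rw [hpp.2] at e1
      have e3 : p.2.2.val = p'.2.2.val := e1.trans e2.symm
      refine Prod.ext (Prod.ext ?_ (Fin.ext ?_)) (Prod.ext hpp.1 (Fin.ext e3))
      · rw [h1, h1', hpp.1]
      · omega
  refine ⟨k + F.card, by omega, ?_⟩
  have := h.sup_edges F (fun p hp hpp => by
    have := ((hF p).1 hp).2.1
    rw [hpp] at this
    omega)
  convert! this using 1
  apply le_antisymm
  · intro a b hab
    by_cases hN : a.2.val / N = b.2.val / N
    · exact Or.inl ⟨hab, hN⟩
    · refine Or.inr ?_
      have hsup : ∀ p ∈ F, SimpleGraph.edge p.1 p.2 ≤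
          F.sup fun p => SimpleGraph.edge p.1 p.2 := fun p hp =>
        Finset.le_sup (f := fun p : (Fin 3 × Fin i) × (Fin 3 × Fin i) =>
          SimpleGraph.edge p.1 p.2) hp
      rcases nestedTriangles_adj.1 hab with ⟨-, h2⟩ | ⟨h1, h2 | h2⟩
      · exact (hN (by rw [h2])).elim
      · exact hsup (a, b) ((hF _).2 ⟨h1, h2, hN⟩)
          ((SimpleGraph.edge_adj _ _ _ _).2 ⟨Or.inl ⟨rfl, rfl⟩, hab.ne⟩)
      · exact hsup (b, a) ((hF _).2 ⟨h1.symm, h2, Ne.symm hN⟩)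
          ((SimpleGraph.edge_adj _ _ _ _).2 ⟨Or.inr ⟨rfl, rfl⟩, hab.ne⟩)
  · refine sup_le (fun a b hab => hab.1) (Finset.sup_le fun p hp => ?_)
    obtain ⟨h1, h2, -⟩ := (hF p).1 hp
    intro a b hab
    rw [SimpleGraph.edge_adj] at hab
    rcases hab with ⟨⟨rfl, rfl⟩ | ⟨rfl, rfl⟩, -⟩
    · exact nestedTriangles_adj.2 (Or.inr ⟨h1, Or.inl h2⟩)
    · exact nestedTriangles_adj.2 (Or.inr ⟨h1.symm, Or.inr h2⟩)

/-! ### Crossing-freeness from prism coordinates -/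

section Prism

variable {N i d : ℕ} {pos : Fin 3 × Fin i → EuclideanSpace ℝ (Fin d)}
  {Φ : (Fin 3 → ℝ) → ℝ → ℕ → EuclideanSpace ℝ (Fin d)}

/-- The points of an edge of `blockTriangles N i` in prism coordinates: barycentric coordinates
`l` in the triangle, height `z` and block number. -/
theorem prism_coordinates
    (hseg : ∀ a b, (blockTriangles N i).Adj a b → ∀ t : ℝ, pos a + t • (pos b - pos a) =
      Φ ((1 - t) • Pi.single a.1 1 + t • Pi.single b.1 1)
        ((1 - t) * a.2.val + t * b.2.val) (a.2.val / N))
    {e : Sym2 (Fin 3 × Fin i)} (he : e ∈ (blockTriangles N i).edgeSet)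
    {x : EuclideanSpace ℝ (Fin d)} (hx : x ∈ segmentArc pos e) :
    ∃ l z q, x = Φ l z q ∧ (∀ j, 0 ≤ l j) ∧ l 0 + l 1 + l 2 = 1 ∧ 0 ≤ z ∧ (∃ c, l c = 0) ∧
      ((∃ (k : ℕ) (c : Fin 3), (∀ w, w ∈ e ↔ w.2.val = k ∧ w.1 ≠ c) ∧ l c = 0 ∧ z = k ∧
        q = k / N) ∨
      (∃ (k : ℕ) (s : Fin 3), (∀ w, w ∈ e ↔ w.1 = s ∧ (w.2.val = k ∨ w.2.val = k + 1)) ∧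
        l = Pi.single s 1 ∧ (k : ℝ) ≤ z ∧ z ≤ k + 1 ∧ q = k / N ∧ q = (k + 1) / N)) := by
  induction e with
  | h a b =>
    have hseg' : segmentArc pos s(a, b) = segment ℝ (pos a) (pos b) := rfl
    rw [hseg', segment_eq_image'] at hx
    obtain ⟨t, ⟨ht0, ht1⟩, rfl⟩ := hx
    have hab : (blockTriangles N i).Adj a b := he
    have ha0 : (0 : ℝ) ≤ a.2.val := Nat.cast_nonneg _
    have hb0 : (0 : ℝ) ≤ b.2.val := Nat.cast_nonneg _
    have hsingle : ∀ s j : Fin 3, (0 : ℝ) ≤ Pi.single (M := fun _ => ℝ) s 1 j := by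
      intro s j
      rw [Pi.single_apply]; split_ifs <;> norm_num
    have hsum : ∀ s : Fin 3, Pi.single (M := fun _ => ℝ) s 1 0 +
        Pi.single (M := fun _ => ℝ) s 1 1 + Pi.single (M := fun _ => ℝ) s 1 2 = 1 := by
      intro s; fin_cases s <;> simp
    refine ⟨_, _, _, hseg a b hab t, ?_, ?_, ?_, ?_, ?_⟩
    · intro j
      have h1 := hsingle a.1 j
      have h2 := hsingle b.1 j
      simp only [Pi.add_apply, Pi.smul_apply, smul_eq_mul]
      have := sub_nonneg.2 ht1
      positivity
    · simp only [Pi.add_apply, Pi.smul_apply, smul_eq_mul]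
      linear_combination (1 - t) * hsum a.1 + t * hsum b.1
    · have := sub_nonneg.2 ht1
      positivity
    · obtain ⟨c, hc⟩ : ∃ c : Fin 3, c ≠ a.1 ∧ c ≠ b.1 := by
        generalize a.1 = u; generalize b.1 = v; revert u v; decide
      exact ⟨c, by simp [hc.1, hc.2]⟩
    · obtain ⟨h, hN⟩ := hab
      have spoke : ∀ a b : Fin 3 × Fin i, a.1 = b.1 → a.2.val + 1 = b.2.val →
          ∀ w, w ∈ s(a, b) ↔ w.1 = a.1 ∧ (w.2.val = a.2.val ∨ w.2.val = a.2.val + 1) := by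
        intro a b h1 h2 w
        rw [Sym2.mem_iff, Prod.ext_iff, Prod.ext_iff, Fin.ext_iff (a := w.2),
          Fin.ext_iff (a := w.2), ← h1, ← h2]
        tauto
      rcases nestedTriangles_adj.1 h with ⟨h1, h2⟩ | ⟨h1, h2 | h2⟩
      · obtain ⟨c, hca, hcb, hc⟩ : ∃ c : Fin 3, c ≠ a.1 ∧ c ≠ b.1 ∧
            ∀ s, s ≠ c ↔ s = a.1 ∨ s = b.1 := by
          revert h1; generalize a.1 = u; generalize b.1 = v; revert u v; decide
        refine Or.inl ⟨a.2.val, c, fun w => ?_, by simp [hca, hcb],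
          by rw [← h2]; ring, rfl⟩
        rw [Sym2.mem_iff, hc, Prod.ext_iff, Prod.ext_iff, ← h2, ← Fin.ext_iff]
        tauto
      · refine Or.inr ⟨a.2.val, a.1, spoke a b h1 h2, ?_, ?_, ?_, rfl, ?_⟩
        · rw [← h1, ← add_smul, sub_add_cancel, one_smul]
        · rw [← h2]; push_cast; linarith
        · rw [← h2]; push_cast; linarith
        · rw [hN, h2]
      · refine Or.inr ⟨b.2.val, a.1, ?_, ?_, ?_, ?_, hN, ?_⟩
        · rw [Sym2.eq_swap, h1]; exact spoke b a h1.symm h2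
        · rw [← h1, ← add_smul, sub_add_cancel, one_smul]
        · rw [← h2]; push_cast; linarith
        · rw [← h2]; push_cast; linarith
        · rw [h2]

/-- Serves the plane and the space placement alike: once a point determines its barycentric
coordinates and height, incidences can be read off from these coordinates. -/
theorem isCrossingFree_blockTriangles
    (hpos : ∀ v, pos v = Φ (Pi.single v.1 1) v.2.val (v.2.val / N))
    (hseg : ∀ a b, (blockTriangles N i).Adj a b → ∀ t : ℝ, pos a + t • (pos b - pos a) =
      Φ ((1 - t) • Pi.single a.1 1 + t • Pi.single b.1 1)
        ((1 - t) * a.2.val + t * b.2.val) (a.2.val / N))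
    (hinj : ∀ l z q l' z' q', (∀ j, 0 ≤ l j) → (∀ j, 0 ≤ l' j) → l 0 + l 1 + l 2 = 1 →
      l' 0 + l' 1 + l' 2 = 1 → 0 ≤ z → 0 ≤ z' → (∃ c, l c = 0) → (∃ c, l' c = 0) →
      Φ l z q = Φ l' z' q' → l = l' ∧ z = z') :
    IsCrossingFree (blockTriangles N i) pos (segmentArc pos) := by
  have hs0 : ∀ s j : Fin 3, (0 : ℝ) ≤ Pi.single (M := fun _ => ℝ) s 1 j := by
    intro s j
    rw [Pi.single_apply]; split_ifs <;> norm_num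
  have hs1 : ∀ s : Fin 3, Pi.single (M := fun _ => ℝ) s 1 0 +
      Pi.single (M := fun _ => ℝ) s 1 1 + Pi.single (M := fun _ => ℝ) s 1 2 = 1 := by
    intro s; fin_cases s <;> simp
  have hs2 : ∀ s : Fin 3, ∃ c, Pi.single (M := fun _ => ℝ) s 1 c = 0 := by
    intro s; exact ⟨s + 1, by simp⟩
  have hsi : ∀ s s' : Fin 3, (Pi.single s 1 : Fin 3 → ℝ) = Pi.single s' 1 → s = s' := by
    intro s s' h
    by_contra hne
    have := congrFun h s
    simp [hne] at this
  have hz0 : ∀ v : Fin 3 × Fin i, (0 : ℝ) ≤ v.2.val := fun v => Nat.cast_nonneg _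
  refine ⟨?_, ?_, ?_⟩
  · intro v w hvw
    rw [hpos, hpos] at hvw
    obtain ⟨h1, h2⟩ := hinj _ _ _ _ _ _ (hs0 _) (hs0 _) (hs1 _) (hs1 _) (hz0 v) (hz0 w) (hs2 _)
      (hs2 _) hvw
    exact Prod.ext (hsi _ _ h1) (Fin.ext (by exact_mod_cast h2))
  · intro e he w hw
    obtain ⟨l, z, q, hx, hl0, hl1, hz, hlc, h⟩ := prism_coordinates hseg he hw
    rw [hpos] at hx
    obtain ⟨h1, h2⟩ := hinj _ _ _ _ _ _ (hs0 _) hl0 (hs1 _) hl1 (hz0 w) hz (hs2 _) hlc hx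
    rcases h with ⟨k, c, hm, hc, hzk, -⟩ | ⟨k, s, hm, hls, hzk, hzk', -⟩
    · rw [hm]
      refine ⟨by rw [hzk] at h2; exact_mod_cast h2, ?_⟩
      rintro rfl
      rw [← h1] at hc
      simp at hc
    · rw [hm]
      refine ⟨hsi _ _ (h1.trans hls), ?_⟩
      rw [← h2] at hzk hzk'
      have a1 : k ≤ w.2.val := by exact_mod_cast hzk
      have a2 : w.2.val ≤ k + 1 := by exact_mod_cast hzk'
      omega
  · rintro e he f hf hef x ⟨hxe, hxf⟩
    obtain ⟨l, z, q, hx, hl0, hl1, hz, hlc, h⟩ := prism_coordinates hseg he hxe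
    obtain ⟨l', z', q', hx', hl0', hl1', hz', hlc', h'⟩ := prism_coordinates hseg hf hxf
    obtain ⟨rfl, rfl⟩ := hinj _ _ _ _ _ _ hl0 hl0' hl1 hl1' hz hz' hlc hlc' (hx.symm.trans hx')
    clear hl0' hl1' hz' hlc' hxe hxf
    have lvl : ∀ {e : Sym2 (Fin 3 × Fin i)} {P : Fin 3 × Fin i → Prop}, (∀ w, w ∈ e ↔ P w) →
        ∃ v, P v := by
      intro e P h
      induction e with
      | h a b => exact ⟨a, (h a).1 (Sym2.mem_mk_left a b)⟩
    have mixed : ∀ {e f : Sym2 (Fin 3 × Fin i)} {k k' : ℕ} {c s : Fin 3} {q : ℕ},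
        (∀ w, w ∈ e ↔ w.2.val = k ∧ w.1 ≠ c) → l c = 0 → z = k → x = Φ l z q → q = k / N →
        (∀ w, w ∈ f ↔ w.1 = s ∧ (w.2.val = k' ∨ w.2.val = k' + 1)) → l = Pi.single s 1 →
        (k' : ℝ) ≤ z → z ≤ k' + 1 → ∃ w, w ∈ e ∧ w ∈ f ∧ x = pos w := by
      rintro e f k k' c s q hm hc rfl hx rfl hm' rfl h1 h2
      obtain ⟨v, hv, -⟩ := lvl hm
      have a1 : k' ≤ k := by exact_mod_cast h1
      have a2 : k ≤ k' + 1 := by exact_mod_cast h2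
      refine ⟨(s, v.2), (hm _).2 ⟨hv, ?_⟩, (hm' _).2 ⟨rfl, by dsimp only; omega⟩, ?_⟩
      · rintro rfl; simp at hc
      · rw [hx, hpos, hv]
    rcases h with ⟨k, c, hm, hc, hzk, hq⟩ | ⟨k, s, hm, hls, hk1, hk2, hq, hq2⟩ <;>
    rcases h' with ⟨k', c', hm', hc', hzk', hq'⟩ | ⟨k', s', hm', hls', hk1', hk2', hq', hq2'⟩
    -- Two edges of one triangle omit different corners, so at a common point two barycentric
    -- coordinates vanish and the point is the third corner.
    · have hkk : k = k' := by rw [hzk] at hzk'; exact_mod_cast hzk'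
      subst hkk
      have hcc : c ≠ c' := by
        rintro rfl
        exact hef (Sym2.ext fun w => (hm w).trans (hm' w).symm)
      obtain ⟨v, hv, -⟩ := lvl hm
      obtain ⟨s, hs, hs', hall⟩ : ∃ s : Fin 3, s ≠ c ∧ s ≠ c' ∧ ∀ j, j = c ∨ j = c' ∨ j = s := by
        revert hcc; clear * -; revert c c'; decide
      have hls : l s = 1 := by
        have : ∑ j, l j = l s := Finset.sum_eq_single s
          (fun j _ hj => by
            rcases hall j with rfl | rfl | rfl
            exacts [hc, hc', (hj rfl).elim]) (by simp)
        rw [← this, Fin.sum_univ_three, hl1]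
      have hl : l = Pi.single s 1 := by
        funext j
        rcases hall j with rfl | rfl | rfl
        · rw [hc, Pi.single_apply, if_neg hs.symm]
        · rw [hc', Pi.single_apply, if_neg hs'.symm]
        · rw [hls, Pi.single_eq_same]
      refine ⟨(s, v.2), (hm _).2 ⟨hv, hs⟩, (hm' _).2 ⟨hv, hs'⟩, ?_⟩
      rw [hx, hpos, hv, hl, hzk, hq]
    · exact mixed hm hc hzk hx hq hm' hls' hk1' hk2'
    · obtain ⟨w, h1, h2, h3⟩ := mixed hm' hc' hzk' hx' hq' hm hls hk1 hk2
      exact ⟨w, h2, h1, h3⟩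
    · have hss : s = s' := hsi _ _ (hls.symm.trans hls')
      subst hss
      have b1 : k ≤ k' + 1 := by exact_mod_cast hk1.trans hk2'
      have b2 : k' ≤ k + 1 := by exact_mod_cast hk1'.trans hk2
      have b3 : k ≠ k' := by
        rintro rfl
        exact hef (Sym2.ext fun w => (hm w).trans (hm' w).symm)
      -- The common point is the upper end of the lower edge, so its block number is needed as `(k +
      -- 1) / N`.
      have consecutive : ∀ {e f : Sym2 (Fin 3 × Fin i)} {k k' : ℕ} {q : ℕ}, k' = k + 1 →
          (∀ w, w ∈ e ↔ w.1 = s ∧ (w.2.val = k ∨ w.2.val = k + 1)) → z ≤ k + 1 → x = Φ l z q →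
          q = (k + 1) / N → (∀ w, w ∈ f ↔ w.1 = s ∧ (w.2.val = k' ∨ w.2.val = k' + 1)) →
          (k' : ℝ) ≤ z → ∃ w, w ∈ e ∧ w ∈ f ∧ x = pos w := by
        rintro e f k _ q rfl hm h1 hx hq hm' h2
        obtain ⟨v, -, hv⟩ := lvl hm'
        have hlt : k + 1 < i := by have := v.2.isLt; omega
        refine ⟨(s, ⟨k + 1, hlt⟩), (hm _).2 ⟨rfl, Or.inr rfl⟩, (hm' _).2 ⟨rfl, Or.inl rfl⟩, ?_⟩
        push_cast at h2
        rw [hx, hpos, hls, hq, le_antisymm h1 h2]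
        push_cast
        rfl
      rcases Nat.lt_or_ge k k' with h | h
      · exact consecutive (by omega) hm hk2 hx hq2 hm' hk1'
      · obtain ⟨w, h1, h2, h3⟩ := consecutive (k := k') (k' := k) (by omega) hm' hk2' hx' hq2' hm hk1
        exact ⟨w, h2, h1, h3⟩

end Prism

/-! ### The placements in the plane and in space -/

theorem fin_three_eq_zero_or_one_or_two (s : Fin 3) : s = 0 ∨ s = 1 ∨ s = 2 := by revert s; decide

/-- Position of the block triangles in the plane: similar triangles around an interior point. -/
noncomputable def planePrism (l : Fin 3 → ℝ) (z : ℝ) (_ : ℕ) : EuclideanSpace ℝ (Fin 2) :=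
  !₂[(z + 1) * (l 0 - l 2) - 1 / 4, (z + 1) * (l 1 - l 2) - 1 / 8]

/-- The point determines the scaled coordinates `(z + 1) * l j` up to a common additive constant.
Being nonnegative with a zero among them fixes the constant, and their sum is `z + 1`. -/
theorem planePrism_injective {l l' : Fin 3 → ℝ} {z z' : ℝ} {q q' : ℕ} (hl : ∀ j, 0 ≤ l j)
    (hl' : ∀ j, 0 ≤ l' j) (hs : l 0 + l 1 + l 2 = 1) (hs' : l' 0 + l' 1 + l' 2 = 1) (hz : 0 ≤ z)
    (hz' : 0 ≤ z') (hc : ∃ c, l c = 0) (hc' : ∃ c, l' c = 0)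
    (h : planePrism l z q = planePrism l' z' q') : l = l' ∧ z = z' := by
  have e0 : (z + 1) * (l 0 - l 2) = (z' + 1) * (l' 0 - l' 2) := by
    simpa [planePrism] using congrArg (fun x => x 0) h
  have e1 : (z + 1) * (l 1 - l 2) = (z' + 1) * (l' 1 - l' 2) := by
    simpa [planePrism] using congrArg (fun x => x 1) h
  have hd : ∀ j, (z + 1) * l j - (z' + 1) * l' j = (z + 1) * l 2 - (z' + 1) * l' 2 := by
    intro j
    fin_cases j
    · change (z + 1) * l 0 - (z' + 1) * l' 0 = _; linarith
    · change (z + 1) * l 1 - (z' + 1) * l' 1 = _; linarith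
    · rfl
  obtain ⟨c, hc⟩ := hc
  obtain ⟨c', hc'⟩ := hc'
  have h1 : 0 ≤ (z' + 1) * l' c := mul_nonneg (by linarith) (hl' c)
  have h2 : 0 ≤ (z + 1) * l c' := mul_nonneg (by linarith) (hl c')
  have h3 := hd c
  have h4 := hd c'
  rw [hc] at h3
  rw [hc'] at h4
  have h5 : (z + 1) * l 2 - (z' + 1) * l' 2 = 0 := by linarith
  have h6 : ∀ j, (z + 1) * l j = (z' + 1) * l' j := fun j => by linarith [hd j]
  have h7 : z = z' := by
    have : (z + 1) * (l 0 + l 1 + l 2) = (z' + 1) * (l' 0 + l' 1 + l' 2) := by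
      linarith [h6 0, h6 1, h6 2]
    rw [hs, hs'] at this
    linarith
  subst h7
  exact ⟨funext fun j => mul_left_cancel₀ (by linarith : z + 1 ≠ 0) (h6 j), rfl⟩

/-- Position of the block triangles in space: block `q` is the prism over a triangle in cell
`(q / N, q % N)` of a square grid. -/
noncomputable def gridPrism (N : ℕ) (l : Fin 3 → ℝ) (z : ℝ) (q : ℕ) :
    EuclideanSpace ℝ (Fin 3) :=
  !₂[3 * (q / N : ℕ) + 1 + l 1, 3 * (q % N : ℕ) + 1 + l 2, z - N * q + 1]

/-- Cells have spacing 3 while `l 1` and `l 2` lie in [0, 1], so the horizontal position reveals the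
cell, hence the block, and then everything else. -/
theorem gridPrism_injective {N : ℕ} {l l' : Fin 3 → ℝ} {z z' : ℝ} {q q' : ℕ} (hl : ∀ j, 0 ≤ l j)
    (hl' : ∀ j, 0 ≤ l' j) (hs : l 0 + l 1 + l 2 = 1) (hs' : l' 0 + l' 1 + l' 2 = 1)
    (h : gridPrism N l z q = gridPrism N l' z' q') : l = l' ∧ z = z' := by
  have e0 : 3 * ((q / N : ℕ) : ℝ) + 1 + l 1 = 3 * (q' / N : ℕ) + 1 + l' 1 := by
    simpa [gridPrism] using congrArg (fun x => x 0) h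
  have e1 : 3 * ((q % N : ℕ) : ℝ) + 1 + l 2 = 3 * (q' % N : ℕ) + 1 + l' 2 := by
    simpa [gridPrism] using congrArg (fun x => x 1) h
  have e2 : z - N * (q : ℝ) + 1 = z' - N * q' + 1 := by
    simpa [gridPrism] using congrArg (fun x => x 2) h
  have cell : ∀ (a b : ℕ) (x y : ℝ), 0 ≤ x → x ≤ 1 → 0 ≤ y → y ≤ 1 →
      3 * (a : ℝ) + 1 + x = 3 * b + 1 + y → a = b := by
    intro a b x y hx hx1 hy hy1 hab
    have h1 : (a : ℝ) < b + 1 := by linarith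
    have h2 : (b : ℝ) < a + 1 := by linarith
    have h1' : a < b + 1 := by exact_mod_cast h1
    have h2' : b < a + 1 := by exact_mod_cast h2
    omega
  have := hl 0
  have := hl' 0
  have := hl 1
  have := hl' 1
  have := hl 2
  have := hl' 2
  have ha := cell _ _ _ _ (hl 1) (by linarith) (hl' 1) (by linarith) e0
  have hb := cell _ _ _ _ (hl 2) (by linarith) (hl' 2) (by linarith) e1
  have hq : q = q' := by rw [← Nat.div_add_mod q N, ha, hb, Nat.div_add_mod]
  rw [ha] at e0
  rw [hb] at e1
  rw [hq] at e2
  refine ⟨funext fun j => ?_, by linarith⟩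
  rcases fin_three_eq_zero_or_one_or_two j with rfl | rfl | rfl <;> linarith

theorem adj_cases {i : ℕ} {P : Fin 3 × Fin i → Fin 3 × Fin i → Prop}
    (hsymm : ∀ a b, P a b → P b a) (N : ℕ)
    (hT : ∀ (k : Fin i) (s t : Fin 3), s < t → P (s, k) (t, k))
    (hS : ∀ (k k' : Fin i) (s : Fin 3), k.val + 1 = k'.val → k.val / N = k'.val / N →
      P (s, k) (s, k')) (a b : Fin 3 × Fin i) (hab : (blockTriangles N i).Adj a b) : P a b := by
  obtain ⟨s, k⟩ := a
  obtain ⟨t, k'⟩ := b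
  obtain ⟨h, hN⟩ := hab
  rcases nestedTriangles_adj.1 h with ⟨h1, h2⟩ | ⟨h1, h2⟩
  · dsimp only at h1 h2
    subst h2
    rcases lt_or_gt_of_ne h1 with h | h
    · exact hT k s t h
    · exact hsymm _ _ (hT k t s h)
  · dsimp only at h1 h2 hN
    subst h1
    rcases h2 with h2 | h2
    · exact hS k k' s h2 hN
    · exact hsymm _ _ (hS k' k s h2 hN.symm)

/-- Three spoke lines and three lines per triangle. It is applied with `N = i`, where no edge has
been removed. -/
theorem hasSphericalCover_plane (N i : ℕ) :
    HasSphericalCover 1 2 (Fintype.card (Fin 3 ⊕ Fin 3 × Fin i)) (blockTriangles N i) := by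
  -- The common centre is off the origin so that no spoke line passes through the origin, yet close
  -- enough for the origin to stay strictly inside the smallest triangle.
  let o : EuclideanSpace ℝ (Fin 2) := !₂[-1 / 4, -1 / 8]
  let w : Fin 3 → EuclideanSpace ℝ (Fin 2) := ![!₂[1, 0], !₂[0, 1], !₂[-1, -1]]
  let pos : Fin 3 × Fin i → EuclideanSpace ℝ (Fin 2) := fun v => o + ((v.2.val : ℝ) + 1) • w v.1
  have hext : ∀ x y : EuclideanSpace ℝ (Fin 2), x 0 = y 0 → x 1 = y 1 → x = y := by
    intro x y h0 h1
    ext j; fin_cases j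
    exacts [h0, h1]
  have hv : ∀ v : Fin 3 × Fin i, pos v = o + ((v.2.val : ℝ) + 1) • w v.1 := fun v => rfl
  have hw : ∀ s, ∀ j, w s j = ![![1, 0], ![0, 1], ![-1, -1]] s j := by
    intro s j; fin_cases s <;> fin_cases j <;> rfl
  have ho0 : o 0 = -1 / 4 := rfl
  have ho1 : o 1 = -1 / 8 := rfl
  refine hasSphericalCover_of_lines (pos := pos)
    (isCrossingFree_blockTriangles (Φ := planePrism) ?_ ?_ ?_)
    (Sum.elim (fun _ => o) (fun c => o + ((c.2.val : ℝ) + 1) • w (c.1 + 1)))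
    (Sum.elim w (fun c => w (c.1 + 2) - w (c.1 + 1))) ?_ ?_ ?_ ?_
  · rintro ⟨s, k⟩
    apply hext <;> fin_cases s <;> simp [hv, hw, planePrism, ho0, ho1] <;> ring
  · rintro ⟨s, k⟩ ⟨t, k'⟩ ⟨h, -⟩ x
    rcases nestedTriangles_adj.1 h with ⟨-, h2⟩ | ⟨h1, -⟩
    · dsimp only at h2
      subst h2
      apply hext <;> fin_cases s <;> fin_cases t <;>
        simp [hv, hw, planePrism, ho0, ho1] <;> ring
    · dsimp only at h1
      subst h1
      apply hext <;> fin_cases s <;> simp [hv, hw, planePrism, ho0, ho1] <;> ring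
  · intro l z q l' z' q' h1 h2 h3 h4 h5 h6 h7 h8 h9
    exact planePrism_injective h1 h2 h3 h4 h5 h6 h7 h8 h9
  · rintro (s | ⟨c, k⟩) h
    · have h0 := congrArg (fun x => x 0) h
      have h1 := congrArg (fun x => x 1) h
      fin_cases s <;> simp [hw] at h0 h1
    · have h0 := congrArg (fun x => x 0) h
      have h1 := congrArg (fun x => x 1) h
      fin_cases c <;> simp [hw] at h0 h1
  · rintro (s | ⟨c, k⟩) t h
    · have h0 := congrArg (fun x => x 0) h
      have h1 := congrArg (fun x => x 1) h
      fin_cases s <;> simp [hw, ho0, ho1] at h0 h1 <;> linarith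
    · have h0 := congrArg (fun x => x 0) h
      have h1 := congrArg (fun x => x 1) h
      have hk : (0 : ℝ) ≤ k.val := Nat.cast_nonneg _
      fin_cases c <;> simp [hw, ho0, ho1] at h0 h1 <;> linarith
  · rintro ⟨s, k⟩
    exact ⟨Sum.inl s, _, rfl⟩
  · refine adj_cases ?_ N ?_ ?_
    · rintro a b ⟨j, s, t, h1, h2⟩
      exact ⟨j, t, s, h2, h1⟩
    · intro k s t hst
      have : (s = 0 ∧ t = 1) ∨ (s = 1 ∧ t = 2) ∨ (s = 0 ∧ t = 2) := by revert s t; decide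
      rcases this with ⟨rfl, rfl⟩ | ⟨rfl, rfl⟩ | ⟨rfl, rfl⟩
      · refine ⟨Sum.inr (2, k), 0, (k.val : ℝ) + 1, ?_, ?_⟩ <;> apply hext <;>
          simp [hv, hw] <;> ring
      · refine ⟨Sum.inr (0, k), 0, (k.val : ℝ) + 1, ?_, ?_⟩ <;> apply hext <;>
          simp [hv, hw] <;> ring
      · refine ⟨Sum.inr (1, k), (k.val : ℝ) + 1, 0, ?_, ?_⟩ <;> apply hext <;>
          simp [hv, hw] <;> ring
    · intro k k' s _ _
      exact ⟨Sum.inl s, _, _, rfl, rfl⟩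

/-- Blocks in one grid row, column or antidiagonal share the lines of their parallel triangle edges
at each of the `N` heights, giving N² + N² + 2N² lines; the spokes take 3N² vertical ones. The
offsets by 1 keep all lines off the origin. -/
theorem hasSphericalCover_grid {N i : ℕ} (hN : 0 < N) (hi : i ≤ N ^ 3) :
    HasSphericalCover 1 3
      (Fintype.card (Fin 3 × Fin N × Fin N ⊕ Fin N × Fin N ⊕ Fin N × Fin N ⊕ Fin (2 * N) × Fin N))
      (blockTriangles N i) := by
  let pos : Fin 3 × Fin i → EuclideanSpace ℝ (Fin 3) := fun v =>
    gridPrism N (Pi.single v.1 1) v.2.val (v.2.val / N)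
  have hext : ∀ x y : EuclideanSpace ℝ (Fin 3), x 0 = y 0 → x 1 = y 1 → x 2 = y 2 → x = y := by
    intro x y h0 h1 h2
    ext j; fin_cases j
    exacts [h0, h1, h2]
  have hv : ∀ v : Fin 3 × Fin i, pos v = gridPrism N (Pi.single v.1 1) v.2.val (v.2.val / N) :=
    fun v => rfl
  have hq : ∀ k : Fin i, k.val / N < N * N := fun k =>
    Nat.div_lt_of_lt_mul (lt_of_lt_of_le k.isLt (hi.trans_eq (by ring)))
  let A : Fin i → Fin N := fun k => ⟨k.val / N / N, Nat.div_lt_of_lt_mul (hq k)⟩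
  let B : Fin i → Fin N := fun k => ⟨k.val / N % N, Nat.mod_lt _ hN⟩
  let C : Fin i → Fin N := fun k => ⟨k.val % N, Nat.mod_lt _ hN⟩
  have hA : ∀ k, (A k).val = k.val / N / N := fun _ => rfl
  have hB : ∀ k, (B k).val = k.val / N % N := fun _ => rfl
  have hC : ∀ k : Fin i, ((C k).val : ℝ) = k.val - N * (k.val / N : ℕ) := by
    intro k
    have := Nat.div_add_mod k.val N
    rw [eq_sub_iff_add_eq, add_comm]
    exact_mod_cast this
  refine hasSphericalCover_of_lines (pos := pos)
    (isCrossingFree_blockTriangles (Φ := gridPrism N) hv ?_ ?_)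
    (Sum.elim (fun j => gridPrism N (Pi.single j.1 1) 0 0 +
        !₂[3 * (j.2.1.val : ℝ), 3 * (j.2.2.val : ℝ), 0])
      (Sum.elim (fun j => !₂[0, 3 * (j.1.val : ℝ) + 1, (j.2.val : ℝ) + 1])
      (Sum.elim (fun j => !₂[3 * (j.1.val : ℝ) + 1, 0, (j.2.val : ℝ) + 1])
        (fun j => !₂[3 * (j.1.val : ℝ) + 3, 0, (j.2.val : ℝ) + 1]))))
    (Sum.elim (fun _ => !₂[0, 0, 1]) (Sum.elim (fun _ => !₂[1, 0, 0])
      (Sum.elim (fun _ => !₂[0, 1, 0]) (fun _ => !₂[-1, 1, 0])))) ?_ ?_ ?_ ?_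
  · rintro ⟨s, k⟩ ⟨t, k'⟩ ⟨-, hk⟩ x
    dsimp only at hk
    apply hext <;> simp [hv, gridPrism, ← hk] <;> ring
  · intro l z q l' z' q' h1 h2 h3 h4 _ _ _ _ h9
    exact gridPrism_injective h1 h2 h3 h4 h9
  · rintro (j | j | j | j) h
    · simpa using congrArg (fun x => x 2) h
    · simpa using congrArg (fun x => x 0) h
    · simpa using congrArg (fun x => x 1) h
    · simpa using congrArg (fun x => x 1) h
  · have hpos : ∀ n : ℕ, ¬ ((n : ℝ) + 1 = 0) := fun n => by positivity
    rintro (⟨s, a, b⟩ | j | j | j) t h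
    · have h0 := congrArg (fun x => x 0) h
      have ha : (0 : ℝ) ≤ a.val := Nat.cast_nonneg _
      fin_cases s <;> simp [gridPrism] at h0 <;> linarith
    all_goals
      have h2 := congrArg (fun x => x 2) h
      simp [hpos] at h2
  · rintro ⟨s, k⟩
    refine ⟨Sum.inl (s, A k, B k), ((C k).val : ℝ), ?_⟩
    apply hext <;> simp [hv, gridPrism, hA, hB, hC] <;> ring
  · refine adj_cases ?_ N ?_ ?_
    · rintro a b ⟨j, s, t, h1, h2⟩
      exact ⟨j, t, s, h2, h1⟩
    · intro k s t hst
      have : (s = 0 ∧ t = 1) ∨ (s = 1 ∧ t = 2) ∨ (s = 0 ∧ t = 2) := by revert s t; decide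
      rcases this with ⟨rfl, rfl⟩ | ⟨rfl, rfl⟩ | ⟨rfl, rfl⟩
      · refine ⟨Sum.inr (Sum.inl (B k, C k)), 3 * (A k).val + 1, 3 * (A k).val + 2, ?_, ?_⟩ <;>
          apply hext <;> simp [hv, gridPrism, hA, hB, hC] <;> ring
      -- The hypotenuse lies on x + y = 3(A + B) + 3, so its line depends on the cell only through A
      -- + B < 2N.
      · refine ⟨Sum.inr (Sum.inr (Sum.inr (⟨(A k).val + (B k).val, by omega⟩, C k))),
          3 * (B k).val + 1, 3 * (B k).val + 2, ?_, ?_⟩ <;>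
          apply hext <;> simp [hv, gridPrism, hA, hB, hC] <;> ring
      · refine ⟨Sum.inr (Sum.inr (Sum.inl (A k, C k))), 3 * (B k).val + 1, 3 * (B k).val + 2,
          ?_, ?_⟩ <;>
          apply hext <;> simp [hv, gridPrism, hA, hB, hC] <;> ring
    · intro k k' s _ hk
      have hAk : A k = A k' := Fin.ext (by rw [hA, hA, hk])
      have hBk : B k = B k' := Fin.ext (by rw [hB, hB, hk])
      refine ⟨Sum.inl (s, A k, B k), ((C k).val : ℝ), ((C k').val : ℝ), ?_, ?_⟩
      · apply hext <;> simp [hv, gridPrism, hA, hB, hC] <;> ring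
      · rw [hAk, hBk]
        apply hext <;> simp [hv, gridPrism, hA, hB, hC] <;> ring

/-! ### Assembling the bounds -/

theorem HasSphericalCover.exists_sphericalCoverNumber_eq {V : Type*} {l d k : ℕ}
    {G : SimpleGraph V} (h : HasSphericalCover l d k G) :
    ∃ m ≤ k, sphericalCoverNumber l d G = (m : ℕ∞) ∧ HasSphericalCover l d m G := by
  have hmem := csInf_mem (s := {m : ℕ∞ | ∃ k : ℕ, m = (k : ℕ∞) ∧ HasSphericalCover l d k G})
    ⟨_, k, rfl, h⟩
  obtain ⟨m, hm, hG⟩ := hmem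
  have hm' : sphericalCoverNumber l d G = (m : ℕ∞) := hm
  refine ⟨m, ?_, hm', hG⟩
  have : sphericalCoverNumber l d G ≤ k := sInf_le ⟨k, rfl, h⟩
  rw [hm'] at this
  exact_mod_cast this

theorem blockTriangles_self (i : ℕ) : blockTriangles i i = nestedTriangles i := by
  ext a b
  refine ⟨fun h => h.1, fun h => ⟨h, ?_⟩⟩
  rw [Nat.div_eq_of_lt a.2.isLt, Nat.div_eq_of_lt b.2.isLt]

theorem exists_cube_ge {i : ℕ} (hi : 1 ≤ i) :
    ∃ N : ℕ, 0 < N ∧ i ≤ N ^ 3 ∧ (N : ℝ) ^ 2 ≤ 4 * (i : ℝ) ^ ((2 : ℝ) / 3) := by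
  set x : ℝ := (i : ℝ) ^ ((1 : ℝ) / 3) with hx
  have hi' : (1 : ℝ) ≤ i := by exact_mod_cast hi
  have hx1 : 1 ≤ x := Real.one_le_rpow hi' (by norm_num)
  have hx3 : x ^ 3 = i := by
    rw [hx, ← Real.rpow_natCast, ← Real.rpow_mul (by positivity)]
    norm_num
  have hx2 : x ^ 2 = (i : ℝ) ^ ((2 : ℝ) / 3) := by
    rw [hx, ← Real.rpow_natCast, ← Real.rpow_mul (by positivity)]
    norm_num
  -- As `x ≥ 1`, rounding up at most doubles it; squaring gives the factor 4.
  refine ⟨⌈x⌉₊, Nat.ceil_pos.2 (by linarith), ?_, ?_⟩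
  · have : (i : ℝ) ≤ (⌈x⌉₊ : ℝ) ^ 3 := by
      rw [← hx3]
      gcongr
      exact Nat.le_ceil x
    exact_mod_cast this
  · have h1 : (⌈x⌉₊ : ℝ) ≤ 2 * x := by
      have := Nat.ceil_lt_add_one (by linarith : 0 ≤ x)
      linarith
    calc (⌈x⌉₊ : ℝ) ^ 2 ≤ (2 * x) ^ 2 := by gcongr
      _ = _ := by rw [← hx2]; ring

theorem theorem4 :
    ∃ c C : ℝ, 0 < c ∧ 0 < C ∧ ∀ i : ℕ, 1 ≤ i →
      Fintype.card (Fin 3 × Fin i) = 3 * i ∧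
      IsPlanarGraph (nestedTriangles i) ∧
      ∃ s t : ℕ,
        sphericalCoverNumber 1 2 (nestedTriangles i) = (s : ℕ∞) ∧
        sphericalCoverNumber 1 3 (nestedTriangles i) = (t : ℕ∞) ∧
        c * ((3 * i : ℕ) : ℝ) ≤ (s : ℝ) ∧
        (t : ℝ) ≤ C * ((3 * i : ℕ) : ℝ) ^ ((2 : ℝ) / 3) := by
  -- From i ≤ 2s + 2 and s ≥ 1 follows i ≤ 4s, that is 3i / 12 ≤ s. The other constant is 10 · 4,
  -- from t ≤ 10N² and N² ≤ 4i^(2/3).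
  refine ⟨1 / 12, 40, by norm_num, by norm_num, fun i hi => ⟨by simp, ?_, ?_⟩⟩
  · have := hasSphericalCover_plane i i
    rw [blockTriangles_self] at this
    exact this.isPlanarGraph
  · have h2 := hasSphericalCover_plane i i
    rw [blockTriangles_self] at h2
    obtain ⟨s, -, hs, hsG⟩ := h2.exists_sphericalCoverNumber_eq
    obtain ⟨N, hN, hiN, hN2⟩ := exists_cube_ge hi
    obtain ⟨m, hm, hmG⟩ := (hasSphericalCover_grid hN hiN).nestedTriangles_of_block hiN
    obtain ⟨t, ht, htn, -⟩ := hmG.exists_sphericalCoverNumber_eq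
    refine ⟨s, t, hs, htn, ?_, ?_⟩
    · have h1 := le_of_hasSphericalCover hsG
      have h0 : 1 ≤ s := by
        by_contra hcon
        obtain rfl : s = 0 := by omega
        obtain ⟨pos, arc, S, -, -, hpos, -⟩ := hsG
        obtain ⟨j, -⟩ := Set.mem_iUnion.1 (hpos (0, ⟨0, hi⟩))
        exact j.elim0
      have h3 : i ≤ 4 * s := by omega
      have h4 : (i : ℝ) ≤ 4 * s := by exact_mod_cast h3
      push_cast
      linarith
    · have h1 : t ≤ 10 * N ^ 2 := by
        refine (ht.trans hm).trans_eq ?_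
        simp only [Fintype.card_sum, Fintype.card_prod, Fintype.card_fin]
        ring
      have h1' : (t : ℝ) ≤ 10 * (N : ℝ) ^ 2 := by exact_mod_cast h1
      have h3 : (i : ℝ) ^ ((2 : ℝ) / 3) ≤ ((3 * i : ℕ) : ℝ) ^ ((2 : ℝ) / 3) := by
        refine Real.rpow_le_rpow (by positivity) ?_ (by norm_num)
        push_cast
        have : (0 : ℝ) ≤ i := by positivity
        linarith
      linarith
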